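/- Work on $L^2(\mathbb R)$ with $\hbar=1$, position operator $X$, momentum operator $P=-i\,d/dx$, and let $\Theta=\mathbf 1_{[0,\infty)}$, so that $\Theta(aX+bP+c)$ is the spectral projection of the self-adjoint operator $aX+bP+c$ onto $[0,\infty)$. A state is a positive semidefinite trace-class operator $\rho$ with $\operatorname{tr}\rho=1$; $\mathcal S(R)$ (resp. $\mathcal P(R)$) is the set of states whose position (resp. momentum) is supported in $R$, i.e. $\operatorname{tr}(\rho\,\mathbf 1_R(X))=1$ (resp. $\operatorname{tr}(\rho\,\mathbf 1_R(P))=1$). Put $\Omega=\Theta(X+P)-\Theta(P)$ and $$\varphi(\alpha)=\sup_{\rho\in\mathcal S[-\sqrt\alpha,0]}\operatorname{tr}(\rho\,\Omega)\ (\alpha>0),\quad \varphi(\infty)=\sup_{\rho\in\mathcal S(-\infty,0]}\operatorname{tr}(\rho\,\Omega),\quad E(\beta)=\sup_{\rho\in\mathcal S(-\infty,\beta]}\operatorname{tr}(\rho\,\Omega)\ (\beta\in\mathbb R).$$ These are suprema of nonempty sets of reals that are bounded above. For an affine map $\sigma$ of phase space, say that a problem $\sup_{\rho\in S}\operatorname{tr}(\rho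 A)$ is carried to $\sup_{\rho\in S'}\operatorname{tr}(\rho A')$ by the metaplectic (anti-metaplectic) transformation $\sigma$ if $\sigma$ preserves (reverses the sign of) the commutator $[X,P]$ and there is a unitary (antiunitary) $U$ with $(UXU^{-1},UPU^{-1})=\sigma(X,P)$, $USU^{-1}=S'$ and $UAU^{-1}=A'$. Let $M,\Delta T>0$. Then: 1. $\varphi$ is non-decreasing on $(0,\infty)$ and $\varphi(\infty)=\lim_{\alpha\to\infty}\varphi(\alpha)=\sup_{\alpha>0}\varphi(\alpha)$. 2. $\varphi(\infty)$ equals the Bracken–Melloy constant $$c_{bm}=\sup_{\rho\in\mathcal P[0,\infty)}\operatorname{tr}\Big(\rho\big[\Theta(-X-\tfrac{\Delta T}{M}P)-\Theta(-X)\big]\Big)$$ (in particular the latter does not depend on $M$ and $\Delta T$), and the problem defining $\varphi(\infty)$ is carried to the problem defining $c_{bm}$ by the anti-metaplectic transformation $\sigma(x,p)=\big(-\sqrt{\Delta T/M}\,p,\,-\sqrt{M/\Delta T}\,x\big)$. 3. (Extended standard problem with $\alpha=\infty$.) For every $\beta\in\mathbb R$, $E(\beta)=\sup_{\rho\in\mathcal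 S(-\infty,0]}\operatorname{tr}\big(\rho[\Theta(X+P)-\Theta(P-\beta)]\big)$, and the latter problem is carried to the problem defining $E(\beta)$ by the metaplectic transformation $\sigma(x,p)=(x-\beta,p+\beta)$. 4. (Generalized backflow.) For every $\gamma\in\mathbb R$, with $\beta=\sqrt{\Delta T/M}\,\gamma$, $$\sup_{\rho\in\mathcal P[-\gamma,\infty)}\operatorname{tr}\Big(\rho\big[\Theta(-X-\tfrac{\Delta T}{M}P)-\Theta(-X)\big]\Big)=E(\beta),$$ and the problem defining $E(\beta)$ is carried to this one by the $\sigma$ of part 2. 5. (Backflow under a constant force.) For every $F\in\mathbb R$, with $\beta=\sqrt{\Delta T/M}\;F\Delta T/2$, $$\sup_{\rho\in\mathcal P[0,\infty)}\operatorname{tr}\Big(\rho\big[\Theta(-X-\tfrac{\Delta T}{M}P+\tfrac{F\Delta T^2}{2M})-\Theta(-X)\big]\Big)=E(\beta),$$ and the problem defining $E(\beta)$ is carried to this one by the anti-metaplectic transformation $\sigma(x,p)=\big(-\sqrt{\Delta T/M}\,(p-F\Delta T/2),\,-\sqrt{M/\Delta T}\,x\big)$. (The operator is the one for the Hamiltonian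 $P^2/2M+FX$; since $F$ may have either sign, the Hamiltonian $P^2/2M-FX$ is covered by replacing $F$ with $-F$.) 6. (Quantum reentry.) For $l\ge 0$ and $0<t_1<t_2$, with $C=(t_2-t_1)/t_2$ and $\beta=-\sqrt{MC/t_1}\;l$, $$\sup_{\rho\in\mathcal S(-\infty,0]}\operatorname{tr}\Big(\rho\big[\Theta(l-X-\tfrac{t_2}{M}P)-\Theta(l-X-\tfrac{t_1}{M}P)\big]\Big)=E(\beta),$$ and the problem defining $E(\beta)$ is carried to this one by the anti-metaplectic transformation $\sigma(x,p)=\Big(\sqrt{\tfrac{MC}{t_1}}\,(x-l),\ \sqrt{\tfrac{M}{t_1C}}\,\big(l-x-\tfrac{t_1}{M}p\big)\Big)$. -/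

import Mathlib

open MeasureTheory Filter Topology

namespace Backflow

noncomputable section

/-! ### The Hilbert space and the affine observables `aX + bP + c` (units with `ℏ = 1`) -/

/-- The Hilbert space `L²(ℝ; ℂ)` of a particle on the line. -/
abbrev HSpace : Type := Lp ℂ 2 (volume : Measure ℝ)

theorem memLp_mul (g : ℝ → ℂ) (hg : Measurable g) (hb : ∃ C : ℝ, ∀ x, ‖g x‖ ≤ C) (ψ : HSpace) :
    MemLp (fun x => g x * ψ x) 2 (volume : Measure ℝ) :=
  MemLp.of_le_mul (c := hb.choose) (Lp.memLp ψ)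
    (hg.aestronglyMeasurable.mul (Lp.aestronglyMeasurable ψ))
    (Eventually.of_forall fun x => by
      rw [norm_mul]
      exact mul_le_mul_of_nonneg_right (hb.choose_spec x) (norm_nonneg _))

/-- Multiplication by a bounded measurable function, as a bounded operator on `L²(ℝ)`. -/
def mulOp (g : ℝ → ℂ) (hg : Measurable g) (hb : ∃ C : ℝ, ∀ x, ‖g x‖ ≤ C) : HSpace →L[ℂ] HSpace :=
  LinearMap.mkContinuous
    { toFun := fun ψ => (memLp_mul g hg hb ψ).toLp _
      map_add' := fun ψ χ => by
        rw [← MemLp.toLp_add]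
        refine MemLp.toLp_congr _ _ ?_
        filter_upwards [Lp.coeFn_add ψ χ] with x hx
        simp only [hx, Pi.add_apply, mul_add]
      map_smul' := fun r ψ => by
        rw [RingHom.id_apply, ← MemLp.toLp_const_smul]
        refine MemLp.toLp_congr _ _ ?_
        filter_upwards [Lp.coeFn_smul r ψ] with x hx
        simp only [hx, Pi.smul_apply, smul_eq_mul]
        ring }
    hb.choose
    (fun ψ => Lp.norm_le_mul_norm_of_ae_le_mul (by
      filter_upwards [MemLp.coeFn_toLp (memLp_mul g hg hb ψ)] with x hx
      rw [LinearMap.coe_mk, AddHom.coe_mk, hx, norm_mul]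
      exact mul_le_mul_of_nonneg_right (hb.choose_spec x) (norm_nonneg _)))

/-- Translation, `ψ ↦ ψ(· + s)`, as a bounded operator on `L²(ℝ)`; this is `exp (i s P)`. -/
def translate (s : ℝ) : HSpace →L[ℂ] HSpace :=
  (Lp.compMeasurePreservingₗᵢ ℂ (fun x : ℝ => x + s)
    (measurePreserving_add_right volume s)).toContinuousLinearMap

/-- The function `(x, p) ↦ a x + b p + c` on phase space. -/
@[ext] structure Affine where
  a : ℝ
  b : ℝ
  c : ℝ

/-- An affine map `σ` of phase space, given by its two components. -/
structure AffineMap2 where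
  fst : Affine
  snd : Affine

/-- The function `A ∘ σ` on phase space. -/
def Affine.comp (A : Affine) (σ : AffineMap2) : Affine where
  a := A.a * σ.fst.a + A.b * σ.snd.a
  b := A.a * σ.fst.b + A.b * σ.snd.b
  c := A.a * σ.fst.c + A.b * σ.snd.c + A.c

/-- The unitary group `t ↦ exp (i t (aX + bP + c))`, where `X` is multiplication by `x` and
`P = -i d/dx`:  `(exp (i t (aX + bP + c)) ψ)(x) = exp (i (t a x + t² a b / 2 + t c)) ψ(x + t b)`. -/
def expGroup (A : Affine) (t : ℝ) : HSpace →L[ℂ] HSpace :=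
  (mulOp (fun x : ℝ =>
      Complex.exp (((t * A.a * x + t ^ 2 * A.a * A.b / 2 + t * A.c : ℝ) : ℂ) * Complex.I))
    (by fun_prop) ⟨1, fun x => (Complex.norm_exp_ofReal_mul_I _).le⟩).comp (translate (t * A.b))

/-! ### Functional calculus -/

/-- `Q = f(A)` for the self-adjoint operator `A = aX + bP + c`: for every vector `ψ` one has
`⟨ψ, Q ψ⟩ = ∫ f dμ`, where `μ` is the spectral distribution of `A` in `ψ`, that is, the finite
measure with characteristic function `t ↦ ⟨ψ, exp (i t A) ψ⟩`. -/
def IsFunctionOf (A : Affine) (f : ℝ → ℝ) (Q : HSpace →L[ℂ] HSpace) : Prop :=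
  ∀ ψ : HSpace, ∃ μ : Measure ℝ, IsFiniteMeasure μ ∧
    (∀ t : ℝ, charFun μ t = inner ℂ ψ (expGroup A t ψ)) ∧
    inner ℂ ψ (Q ψ) = ((∫ s, f s ∂μ : ℝ) : ℂ)

open Classical in
/-- The operator `f(aX + bP + c)`. It exists and is unique for every bounded measurable `f`, see
`isFunctionOf_functionOf` and `IsFunctionOf.unique`. -/
def functionOf (f : ℝ → ℝ) (A : Affine) : HSpace →L[ℂ] HSpace :=
  if h : ∃ Q, IsFunctionOf A f Q then h.choose else 0

theorem IsFunctionOf.unique {A : Affine} {f : ℝ → ℝ} {Q Q' : HSpace →L[ℂ] HSpace}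
    (h : IsFunctionOf A f Q) (h' : IsFunctionOf A f Q') : Q = Q' := by
  have key : ∀ ψ : HSpace, inner ℂ (Q ψ) ψ = inner ℂ (Q' ψ) ψ := by
    intro ψ
    obtain ⟨μ, hμ, hc, hQ⟩ := h ψ
    obtain ⟨μ', hμ', hc', hQ'⟩ := h' ψ
    have hμμ : μ = μ' := Measure.ext_of_charFun (funext fun t => (hc t).trans (hc' t).symm)
    have e : inner ℂ ψ (Q ψ) = inner ℂ ψ (Q' ψ) := by rw [hQ, hQ', hμμ]
    rw [← inner_conj_symm, e, inner_conj_symm]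
  have := (ext_inner_map Q.toLinearMap Q'.toLinearMap).1 key
  exact ContinuousLinearMap.coe_injective this

theorem mulOp_coeFn (g : ℝ → ℂ) (hg : Measurable g) (hb : ∃ C : ℝ, ∀ x, ‖g x‖ ≤ C)
    (ψ : HSpace) : (mulOp g hg hb ψ : ℝ → ℂ) =ᵐ[volume] fun x => g x * ψ x := 
  MemLp.coeFn_toLp (memLp_mul g hg hb ψ)

theorem translate_coeFn (s : ℝ) (ψ : HSpace) :
    (translate s ψ : ℝ → ℂ) =ᵐ[volume] fun x => ψ (x + s) :=
  Lp.coeFn_compMeasurePreserving ψ (measurePreserving_add_right volume s)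

/-- The Fourier transform turns translations into modulations. -/
theorem fourier_translate (s : ℝ) (ψ : HSpace) :
    Lp.fourierTransformₗᵢ ℝ ℂ (translate s ψ) =
      mulOp (fun ξ : ℝ => Complex.exp (((2 * Real.pi * s * ξ : ℝ) : ℂ) * Complex.I)) (by fun_prop)
        ⟨1, fun x => (Complex.norm_exp_ofReal_mul_I _).le⟩ (Lp.fourierTransformₗᵢ ℝ ℂ ψ) := by
  refine DenseRange.induction_on
    (p := fun ψ : HSpace => Lp.fourierTransformₗᵢ ℝ ℂ (translate s ψ) =
      mulOp (fun ξ : ℝ => Complex.exp (((2 * Real.pi * s * ξ : ℝ) : ℂ) * Complex.I)) (by fun_prop)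
        ⟨1, fun x => (Complex.norm_exp_ofReal_mul_I _).le⟩ (Lp.fourierTransformₗᵢ ℝ ℂ ψ))
    (SchwartzMap.denseRange_toLpCLM (p := 2) ENNReal.ofNat_ne_top) ψ ?_ ?_
  · exact isClosed_eq ((LinearIsometryEquiv.continuous _).comp (translate s).continuous)
      ((ContinuousLinearMap.continuous _).comp (LinearIsometryEquiv.continuous _))
  · intro f
    have h1 : translate s (f.toLp 2) = (f.compSubConstCLM ℝ (-s)).toLp 2 := by
      refine Lp.ext ?_
      have hq : (fun x => (f.toLp 2 : ℝ → ℂ) (x + s)) =ᵐ[volume] fun x => f (x + s) :=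
        (measurePreserving_add_right volume s).quasiMeasurePreserving.ae_eq_comp
          (f.coeFn_toLp 2)
      filter_upwards [translate_coeFn s (f.toLp 2), hq,
        (f.compSubConstCLM ℝ (-s)).coeFn_toLp 2] with x h1 h2 h3
      rw [h1, h2, h3, SchwartzMap.compSubConstCLM_apply, sub_neg_eq_add]
    change Lp.fourierTransformₗᵢ ℝ ℂ (translate s (f.toLp 2)) = mulOp _ _ _
      (Lp.fourierTransformₗᵢ ℝ ℂ (f.toLp 2))
    rw [h1]
    have h2 : ∀ g : SchwartzMap ℝ ℂ, Lp.fourierTransformₗᵢ ℝ ℂ (g.toLp 2) =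
        (FourierTransform.fourier g : SchwartzMap ℝ ℂ).toLp 2 := SchwartzMap.toLp_fourier_eq
    rw [h2, h2]
    refine Lp.ext ?_
    filter_upwards [(FourierTransform.fourier f : SchwartzMap ℝ ℂ).coeFn_toLp 2,
      (FourierTransform.fourier (f.compSubConstCLM ℝ (-s)) : SchwartzMap ℝ ℂ).coeFn_toLp 2,
      mulOp_coeFn (fun ξ : ℝ => Complex.exp (((2 * Real.pi * s * ξ : ℝ) : ℂ) * Complex.I))
        (by fun_prop) ⟨1, fun x => (Complex.norm_exp_ofReal_mul_I _).le⟩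
        ((FourierTransform.fourier f : SchwartzMap ℝ ℂ).toLp 2)] with ξ h3 h4 h5
    rw [h4, h5, h3]
    rw [SchwartzMap.fourier_coe, SchwartzMap.fourier_coe, Real.fourier_eq', Real.fourier_eq',
      ← integral_add_right_eq_self _ (-s), ← integral_const_mul]
    refine integral_congr_ae (Eventually.of_forall fun x => ?_)
    simp only [SchwartzMap.compSubConstCLM_apply, smul_eq_mul]
    rw [← mul_assoc, ← Complex.exp_add]
    congr 2
    · simp
      ring
    · simp

theorem mulOp_inner_left (g : ℝ → ℂ) (hg : Measurable g) (hb : ∃ C : ℝ, ∀ x, ‖g x‖ ≤ C)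
    (ψ χ : HSpace) : inner ℂ χ (mulOp g hg hb ψ) = ∫ x, g x * inner ℂ (χ x) (ψ x) := by
  rw [L2.inner_def]
  refine integral_congr_ae ?_
  filter_upwards [mulOp_coeFn g hg hb ψ] with x hx
  rw [hx]
  simp only [RCLike.inner_apply]
  ring

/-- If an isometry `V` turns `exp (i t A)` into multiplication by `exp (i t g)`, then
`V* f(g) V` is `f(A)`. -/
theorem isFunctionOf_of_diagonal (A : Affine) (V : HSpace →L[ℂ] HSpace)
    (hV : ∀ ψ χ : HSpace, inner ℂ (V ψ) (V χ) = (inner ℂ ψ χ : ℂ))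
    (g : ℝ → ℝ) (hg : Measurable g)
    (hVg : ∀ t ψ, (V (expGroup A t ψ) : ℝ → ℂ) =ᵐ[volume]
      fun x => Complex.exp (((t * g x : ℝ) : ℂ) * Complex.I) * V ψ x)
    (f : ℝ → ℝ) (hf : Measurable f) (hb : ∃ C : ℝ, ∀ x, |f x| ≤ C) :
    ∃ Q, IsFunctionOf A f Q := by
  have hfm : Measurable fun x => ((f (g x) : ℝ) : ℂ) :=
    Complex.measurable_ofReal.comp (hf.comp hg)
  have hfb : ∃ C : ℝ, ∀ x, ‖((f (g x) : ℝ) : ℂ)‖ ≤ C := by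
    obtain ⟨C, hC⟩ := hb
    exact ⟨C, fun x => by rw [Complex.norm_real]; exact hC _⟩
  refine ⟨(ContinuousLinearMap.adjoint V).comp ((mulOp _ hfm hfb).comp V), fun ψ => ?_⟩
  have hint : Integrable (fun x => ‖V ψ x‖ ^ 2) (volume : Measure ℝ) :=
    (memLp_two_iff_integrable_sq_norm (Lp.aestronglyMeasurable _)).1 (Lp.memLp (V ψ))
  have hae : AEMeasurable (fun x => ENNReal.ofReal (‖V ψ x‖ ^ 2)) (volume : Measure ℝ) :=
    hint.aestronglyMeasurable.aemeasurable.ennreal_ofReal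
  have hfin : IsFiniteMeasure
      ((volume : Measure ℝ).withDensity fun x => ENNReal.ofReal (‖V ψ x‖ ^ 2)) :=
    isFiniteMeasure_withDensity_ofReal hint.2
  have hchange : ∀ F : ℝ → ℂ, Measurable F →
      ∫ s, F s ∂(((volume : Measure ℝ).withDensity
        fun x => ENNReal.ofReal (‖V ψ x‖ ^ 2)).map g) =
      ∫ x, F (g x) * inner ℂ (V ψ x) (V ψ x) := by
    intro F hF
    rw [integral_map hg.aemeasurable hF.aestronglyMeasurable,
      integral_withDensity_eq_integral_toReal_smul₀ hae
        (Eventually.of_forall fun _ => ENNReal.ofReal_lt_top)]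
    refine integral_congr_ae (Eventually.of_forall fun x => ?_)
    simp only
    rw [ENNReal.toReal_ofReal (by positivity), inner_self_eq_norm_sq_to_K, Complex.real_smul,
      mul_comm]
    simp
  refine ⟨((volume : Measure ℝ).withDensity fun x => ENNReal.ofReal (‖V ψ x‖ ^ 2)).map g,
    Measure.isFiniteMeasure_map _ g, fun t => ?_, ?_⟩
  · rw [charFun_apply_real, hchange _ (by fun_prop), ← hV, L2.inner_def]
    refine integral_congr_ae ?_
    filter_upwards [hVg t ψ] with x hx
    rw [hx]
    simp only [RCLike.inner_apply, Complex.ofReal_mul]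
    ring
  · rw [ContinuousLinearMap.comp_apply, ContinuousLinearMap.adjoint_inner_right,
      ContinuousLinearMap.comp_apply, mulOp_inner_left, ← integral_complex_ofReal]
    exact (hchange (fun s => ((f s : ℝ) : ℂ)) (Complex.measurable_ofReal.comp hf)).symm

theorem exists_isFunctionOf (A : Affine) (f : ℝ → ℝ) (hf : Measurable f)
    (hb : ∃ C : ℝ, ∀ x, |f x| ≤ C) : ∃ Q, IsFunctionOf A f Q := by
  have hexp : ∀ t ψ, (expGroup A t ψ : ℝ → ℂ) =ᵐ[volume] fun x =>
      Complex.exp (((t * A.a * x + t ^ 2 * A.a * A.b / 2 + t * A.c : ℝ) : ℂ) * Complex.I) *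
        ψ (x + t * A.b) := fun t ψ => by
    unfold expGroup
    rw [ContinuousLinearMap.comp_apply]
    filter_upwards [mulOp_coeFn (fun x : ℝ =>
      Complex.exp (((t * A.a * x + t ^ 2 * A.a * A.b / 2 + t * A.c : ℝ) : ℂ) * Complex.I))
      (by fun_prop) ⟨1, fun x => (Complex.norm_exp_ofReal_mul_I _).le⟩ (translate (t * A.b) ψ),
      translate_coeFn (t * A.b) ψ] with x h1 h2
    rw [h1, h2]
  by_cases hA : A.b = 0
  · refine isFunctionOf_of_diagonal A (ContinuousLinearMap.id ℂ HSpace) (fun _ _ => rfl)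
      (fun x => A.a * x + A.c) (by fun_prop) (fun t ψ => ?_) f hf hb
    filter_upwards [hexp t ψ] with x hx
    simp only [ContinuousLinearMap.id_apply]
    rw [hx, hA]
    congr 2
    · push_cast
      ring
    · simp
  · set chirp : HSpace →L[ℂ] HSpace :=
      mulOp (fun x : ℝ => Complex.exp (((A.a * x ^ 2 / (2 * A.b) : ℝ) : ℂ) * Complex.I))
        (by fun_prop) ⟨1, fun x => (Complex.norm_exp_ofReal_mul_I _).le⟩ with hchirp
    have hchirp_ae : ∀ ψ, (chirp ψ : ℝ → ℂ) =ᵐ[volume] fun x =>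
        Complex.exp (((A.a * x ^ 2 / (2 * A.b) : ℝ) : ℂ) * Complex.I) * ψ x :=
      fun ψ => mulOp_coeFn _ _ _ ψ
    have hchirp_inner : ∀ ψ χ : HSpace, inner ℂ (chirp ψ) (chirp χ) = (inner ℂ ψ χ : ℂ) := by
      intro ψ χ
      rw [L2.inner_def, L2.inner_def]
      refine integral_congr_ae ?_
      filter_upwards [hchirp_ae ψ, hchirp_ae χ] with x h1 h2
      rw [h1, h2]
      simp only [RCLike.inner_apply, map_mul, ← Complex.exp_conj, Complex.conj_I,
        Complex.conj_ofReal]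
      rw [mul_mul_mul_comm, ← Complex.exp_add]
      simp
    refine isFunctionOf_of_diagonal A
      ((Lp.fourierTransformₗᵢ ℝ ℂ).toContinuousLinearEquiv.toContinuousLinearMap.comp chirp)
      (fun ψ χ => ?_) (fun ξ => 2 * Real.pi * A.b * ξ + A.c) (by fun_prop) (fun t ψ => ?_) f hf hb
    · exact ((Lp.fourierTransformₗᵢ ℝ ℂ).inner_map_map _ _).trans (hchirp_inner ψ χ)
    · have h1 : chirp (expGroup A t ψ) =
          Complex.exp (((t * A.c : ℝ) : ℂ) * Complex.I) • translate (t * A.b) (chirp ψ) := by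
        refine Lp.ext ?_
        have hq : (fun x => (chirp ψ : ℝ → ℂ) (x + t * A.b)) =ᵐ[volume] fun x =>
            Complex.exp (((A.a * (x + t * A.b) ^ 2 / (2 * A.b) : ℝ) : ℂ) * Complex.I) *
              ψ (x + t * A.b) :=
          (measurePreserving_add_right volume (t * A.b)).quasiMeasurePreserving.ae_eq_comp
            (hchirp_ae ψ)
        filter_upwards [hchirp_ae (expGroup A t ψ), hexp t ψ, translate_coeFn (t * A.b) (chirp ψ),
          Lp.coeFn_smul (Complex.exp (((t * A.c : ℝ) : ℂ) * Complex.I))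
            (translate (t * A.b) (chirp ψ)), hq] with x h1 h2 h3 h4 h5
        rw [h1, h2, h4, Pi.smul_apply, h3, h5, smul_eq_mul, ← mul_assoc, ← mul_assoc,
          ← Complex.exp_add, ← Complex.exp_add, ← add_mul, ← add_mul, ← Complex.ofReal_add,
          ← Complex.ofReal_add]
        congr 4
        field_simp
        ring
      change (Lp.fourierTransformₗᵢ ℝ ℂ (chirp (expGroup A t ψ)) : ℝ → ℂ) =ᵐ[volume] fun ξ => _ *
        (Lp.fourierTransformₗᵢ ℝ ℂ (chirp ψ) : ℝ → ℂ) ξ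
      rw [h1, LinearIsometryEquiv.map_smul, fourier_translate]
      filter_upwards [Lp.coeFn_smul (Complex.exp (((t * A.c : ℝ) : ℂ) * Complex.I))
          (mulOp (fun ξ : ℝ =>
            Complex.exp (((2 * Real.pi * (t * A.b) * ξ : ℝ) : ℂ) * Complex.I)) (by fun_prop)
            ⟨1, fun x => (Complex.norm_exp_ofReal_mul_I _).le⟩
            (Lp.fourierTransformₗᵢ ℝ ℂ (chirp ψ))),
        mulOp_coeFn (fun ξ : ℝ =>
            Complex.exp (((2 * Real.pi * (t * A.b) * ξ : ℝ) : ℂ) * Complex.I)) (by fun_prop)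
            ⟨1, fun x => (Complex.norm_exp_ofReal_mul_I _).le⟩
            (Lp.fourierTransformₗᵢ ℝ ℂ (chirp ψ))] with ξ h2 h3
      rw [h2, Pi.smul_apply, h3, smul_eq_mul, ← mul_assoc, ← Complex.exp_add, ← add_mul,
        ← Complex.ofReal_add]
      congr 4
      ring

/-- The operator `f(aX + bP + c)` is well defined. -/
theorem isFunctionOf_functionOf (A : Affine) (f : ℝ → ℝ) (hf : Measurable f)
    (hb : ∃ C : ℝ, ∀ x, |f x| ≤ C) : IsFunctionOf A f (functionOf f A) := by
  unfold functionOf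
  rw [dif_pos (exists_isFunctionOf A f hf hb)]
  exact (exists_isFunctionOf A f hf hb).choose_spec

open Classical in
/-- The spectral projection `1_R(aX + bP + c)`. -/
def spectralProj (R : Set ℝ) (A : Affine) : HSpace →L[ℂ] HSpace :=
  functionOf (R.indicator fun _ => 1) A

/-- `Θ(aX + bP + c)`, with `Θ` the Heaviside step function. -/
def heaviside (A : Affine) : HSpace →L[ℂ] HSpace := spectralProj (Set.Ici 0) A

/-! ### States -/

/-- The position operator `X`. -/
def posX : Affine := ⟨1, 0, 0⟩

/-- The momentum operator `P`. -/
def momP : Affine := ⟨0, 1, 0⟩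

/-- The index set of a Hilbert basis of `L²(ℝ)`. -/
def basisIndex : Set HSpace := (exists_hilbertBasis ℂ HSpace).choose

/-- A Hilbert basis of `L²(ℝ)`. -/
def stdBasis : HilbertBasis basisIndex ℂ HSpace := (exists_hilbertBasis ℂ HSpace).choose_spec.choose

/-- The trace of a trace-class operator. -/
def trace (T : HSpace →L[ℂ] HSpace) : ℂ := ∑' i, inner ℂ (stdBasis i) (T (stdBasis i))

/-- Density operators: positive semidefinite, trace class, of trace one. -/
def IsState (ρ : HSpace →L[ℂ] HSpace) : Prop :=
  ρ.IsPositive ∧ HasSum (fun i => (inner ℂ (stdBasis i) (ρ (stdBasis i)) : ℂ)) 1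

/-- `𝒮(R)`: the states with position support in `R`, i.e. those that are found in `R` with
probability one. -/
def positionStates (R : Set ℝ) : Set (HSpace →L[ℂ] HSpace) :=
  {ρ | IsState ρ ∧ trace (ρ.comp (spectralProj R posX)) = 1}

/-- `𝒫(R)`: the states with momentum support in `R`. -/
def momentumStates (R : Set ℝ) : Set (HSpace →L[ℂ] HSpace) :=
  {ρ | IsState ρ ∧ trace (ρ.comp (spectralProj R momP)) = 1}

/-! ### Optimization problems over states -/

/-- An optimization problem `sup {tr (ρ O) : ρ ∈ S}`. -/
structure Problem where
  states : Set (HSpace →L[ℂ] HSpace)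
  op : HSpace →L[ℂ] HSpace

/-- The expectation values `tr (ρ O)`, `ρ ∈ S`. -/
def Problem.values (p : Problem) : Set ℝ := {v | ∃ ρ ∈ p.states, (trace (ρ.comp p.op)).re = v}

/-- The supremum of the problem. -/
def Problem.value (p : Problem) : ℝ := sSup p.values

/-- The standard problem: `Ω = Θ(X + P) - Θ(P)` over `𝒮[-√α, 0]`. -/
def standard (α : ℝ) : Problem where
  states := positionStates (Set.Icc (-√α) 0)
  op := heaviside ⟨1, 1, 0⟩ - heaviside momP

/-- `φ(α)`. -/
def phi (α : ℝ) : ℝ := (standard α).value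

/-- The standard problem with `α = ∞`: `Ω = Θ(X + P) - Θ(P)` over `𝒮(-∞, 0]`. -/
def standardInfinite : Problem where
  states := positionStates (Set.Iic 0)
  op := heaviside ⟨1, 1, 0⟩ - heaviside momP

/-- `φ(∞)`. -/
def phiInfinity : ℝ := standardInfinite.value

/-- The extended standard problem with `α = ∞` in its original form:
`Θ(X + P) - Θ(P + β)` over `𝒮(-∞, 0]`; its value is `φ(∞, β)`. -/
def penalized (β : ℝ) : Problem where
  states := positionStates (Set.Iic 0)
  op := heaviside ⟨1, 1, 0⟩ - heaviside ⟨0, 1, β⟩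

/-- The extended standard problem with `α = ∞` in its translated form:
`Ω = Θ(X + P) - Θ(P)` over `𝒮(-∞, β]`. -/
def extended (β : ℝ) : Problem where
  states := positionStates (Set.Iic β)
  op := heaviside ⟨1, 1, 0⟩ - heaviside momP

/-- Quantum backflow: `Θ(-X - (ΔT/M) P) - Θ(-X)` over `𝒫[0, ∞)`. -/
def backflow (M ΔT : ℝ) : Problem where
  states := momentumStates (Set.Ici 0)
  op := heaviside ⟨-1, -(ΔT / M), 0⟩ - heaviside ⟨-1, 0, 0⟩

/-- The Bracken–Melloy constant. -/
def brackenMelloy (M ΔT : ℝ) : ℝ := (backflow M ΔT).value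

/-- Generalized backflow: `Θ(-X - (ΔT/M) P) - Θ(-X)` over `𝒫[-γ, ∞)`. -/
def generalizedBackflow (M ΔT γ : ℝ) : Problem where
  states := momentumStates (Set.Ici (-γ))
  op := heaviside ⟨-1, -(ΔT / M), 0⟩ - heaviside ⟨-1, 0, 0⟩

/-- Backflow under a constant force, in the form
`Θ(-X - (ΔT/M) P + F ΔT²/(2M)) - Θ(-X)` over `𝒫[0, ∞)`. For the Hamiltonian `P²/(2M) - F₀ X`, the
position at time `ΔT` is `X + (ΔT/M) P + F₀ ΔT²/(2M)`, which corresponds to `F = -F₀`. -/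
def forceBackflow (M ΔT F : ℝ) : Problem where
  states := momentumStates (Set.Ici 0)
  op := heaviside ⟨-1, -(ΔT / M), F * ΔT ^ 2 / (2 * M)⟩ - heaviside ⟨-1, 0, 0⟩

/-- Quantum reentry: `Θ(l - X - (t₂/M) P) - Θ(l - X - (t₁/M) P)` over `𝒮(-∞, 0]`. -/
def reentry (M l t₁ t₂ : ℝ) : Problem where
  states := positionStates (Set.Iic 0)
  op := heaviside ⟨-1, -(t₂ / M), l⟩ - heaviside ⟨-1, -(t₁ / M), l⟩

/-! ### Metaplectic and anti-metaplectic equivalence -/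

/-- `U T U⁻¹` for a unitary `U`. -/
def conjUnitary (U : HSpace ≃ₗᵢ[ℂ] HSpace) (T : HSpace →L[ℂ] HSpace) : HSpace →L[ℂ] HSpace :=
  (U.toContinuousLinearEquiv : HSpace →L[ℂ] HSpace).comp
    (T.comp (U.symm.toContinuousLinearEquiv : HSpace →L[ℂ] HSpace))

/-- `J T J⁻¹` for an antiunitary `J`. -/
def conjAntiunitary (J : HSpace ≃ₗᵢ⋆[ℂ] HSpace) (T : HSpace →L[ℂ] HSpace) : HSpace →L[ℂ] HSpace :=
  (J.toContinuousLinearEquiv : HSpace →SL[starRingEnd ℂ] HSpace).comp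
    (T.comp (J.symm.toContinuousLinearEquiv : HSpace →SL[starRingEnd ℂ] HSpace))

/-- `p` is carried to `q` by a unitary `U` with `(U X U⁻¹, U P U⁻¹) = σ(X, P)`, where `σ` preserves
the commutator. The intertwining relation is stated for the groups generated by all `aX + bP + c`. -/
def MetaplecticEquiv (σ : AffineMap2) (p q : Problem) : Prop :=
  σ.fst.a * σ.snd.b - σ.fst.b * σ.snd.a = 1 ∧
  ∃ U : HSpace ≃ₗᵢ[ℂ] HSpace,
    (∀ A t, conjUnitary U (expGroup A t) = expGroup (A.comp σ) t) ∧
    conjUnitary U '' p.states = q.states ∧ conjUnitary U p.op = q.op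

/-- `p` is carried to `q` by an antiunitary `J` with `(J X J⁻¹, J P J⁻¹) = σ(X, P)`, where `σ`
reverses the commutator. As `J` is antilinear, `J exp (i t A) J⁻¹ = exp (-i t J A J⁻¹)`. -/
def AntiMetaplecticEquiv (σ : AffineMap2) (p q : Problem) : Prop :=
  σ.fst.a * σ.snd.b - σ.fst.b * σ.snd.a = -1 ∧
  ∃ J : HSpace ≃ₗᵢ⋆[ℂ] HSpace,
    (∀ A t, conjAntiunitary J (expGroup A t) = expGroup (A.comp σ) (-t)) ∧
    conjAntiunitary J '' p.states = q.states ∧ conjAntiunitary J p.op = q.op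

end

end Backflow

open Backflow

/-!
The backflow and reentry problems are extended standard problems in other canonical coordinates,
and the standard problems are governed by pure states.

*Traces.* A density operator factors as `ρ = b b*`. The Hilbert-Schmidt inner product
`∑ ⟨A eᵢ, B eᵢ⟩` equals `∑ ⟨B* fⱼ, A* fⱼ⟩` for any two families `e`, `f` satisfying Parseval's
identity (`hasSum_inner_adjoint`, by Tonelli and polarization), so that
`tr (ρ Q) = ∑ ⟨φⱼ, Q φⱼ⟩` with `φⱼ = b fⱼ`, whatever basis computes the trace
(`IsState.exists_vectors`). This makes traces invariant under unitary and antiunitary conjugation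
(`WignerSymmetry.trace_conj`) and reduces suprema over states to quadratic forms
(`forall_trace_le_iff`).

*The limit `α → ∞`.* A state has position support in `R` exactly when all its `φⱼ` do, and a wave
function on `(-∞, 0]` is the limit of its restrictions to bounded intervals. Hence `φ(∞)` is the
supremum of the `φ(α)` (`isLUB_phi`), which are monotone because the sets of states are.

*The equivalences.* A symmetry that carries the unitary group generated by `A` to the one generated
by `A ∘ σ` carries `f(A)` to `f(A ∘ σ)`, because the spectral distributions have the same
characteristic functions (`WignerSymmetry.conj_functionOf`). The symmetries are composed of three
kinds: `ψ ↦ √k exp (i q(x)) ψ(k x + m)` with `q` quadratic, which transforms `(x, p)` into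
`(k x + m, (p - q'(x)) / k)`; the Fourier transform, `(x, p) ↦ (-p / 2π, 2π x)`; and complex
conjugation, `(x, p) ↦ (x, -p)`. It remains to see that the transformed observables agree with the
required ones up to a factor and a constant, which `spectralProj_rescale` absorbs into the spectral
set; the factor is positive where the spectral set is that of `Θ`.
-/

namespace Backflow

noncomputable section

/-! ### Traces against density operators -/

section Parseval

variable {ι κ H : Type*} [NormedAddCommGroup H] [InnerProductSpace ℂ H]

/-- A family of vectors satisfying Parseval's identity. Unlike a Hilbert basis, this notion is
visibly preserved by unitary and by antiunitary maps. -/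
def IsParseval (e : ι → H) : Prop :=
  ∀ v, HasSum (fun i => ‖(inner ℂ (e i) v : ℂ)‖ ^ 2) (‖v‖ ^ 2)

theorem isParseval_hilbertBasis (b : HilbertBasis ι ℂ H) : IsParseval b := fun v => by
  have h := Complex.hasSum_re (b.hasSum_inner_mul_inner v v)
  rw [inner_self_eq_norm_sq_to_K, ← RCLike.ofReal_pow, RCLike.ofReal_eq_complex_ofReal,
    Complex.ofReal_re] at h
  refine h.congr_fun fun i => ?_
  rw [← inner_conj_symm (b i) v, Complex.mul_conj, Complex.ofReal_re, RCLike.norm_conj,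
    Complex.normSq_eq_norm_sq]

theorem tsum_ofReal_eq_iff_hasSum {f : ι → ℝ} (hf : ∀ i, 0 ≤ f i) {s : ℝ} (hs : 0 ≤ s) :
    ∑' i, ENNReal.ofReal (f i) = ENNReal.ofReal s ↔ HasSum f s := by
  refine ⟨fun h => ?_, fun h => ?_⟩
  · have hsum : Summable f := by
      have := ENNReal.summable_toReal (h.trans_ne ENNReal.ofReal_ne_top)
      simpa only [ENNReal.toReal_ofReal (hf _)] using this
    rw [← ENNReal.ofReal_tsum_of_nonneg hf hsum,
      ENNReal.ofReal_eq_ofReal_iff (tsum_nonneg hf) hs] at h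
    exact h ▸ hsum.hasSum
  · rw [← ENNReal.ofReal_tsum_of_nonneg hf h.summable, h.tsum_eq]

variable [CompleteSpace H]

/-- The Hilbert-Schmidt norm of `A`, computed along any Parseval family, is that of its adjoint,
computed along any other one. -/
theorem hasSum_norm_sq_adjoint {e : ι → H} {f : κ → H} (he : IsParseval e) (hf : IsParseval f)
    (A : H →L[ℂ] H) {s : ℝ} (h : HasSum (fun i => ‖A (e i)‖ ^ 2) s) :
    HasSum (fun j => ‖ContinuousLinearMap.adjoint A (f j)‖ ^ 2) s := by
  have hs : 0 ≤ s := h.nonneg fun i => by positivity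
  rw [← tsum_ofReal_eq_iff_hasSum (fun i => by positivity) hs] at h ⊢
  rw [← h]
  have h1 : ∀ i, ENNReal.ofReal (‖A (e i)‖ ^ 2) =
      ∑' j, ENNReal.ofReal (‖(inner ℂ (f j) (A (e i)) : ℂ)‖ ^ 2) := fun i =>
    ((tsum_ofReal_eq_iff_hasSum (fun j => by positivity) (by positivity)).2 (hf _)).symm
  have h2 : ∀ j, ENNReal.ofReal (‖ContinuousLinearMap.adjoint A (f j)‖ ^ 2) =
      ∑' i, ENNReal.ofReal (‖(inner ℂ (f j) (A (e i)) : ℂ)‖ ^ 2) := fun j => by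
    rw [← (tsum_ofReal_eq_iff_hasSum (fun i => by positivity) (by positivity)).2 (he _)]
    refine tsum_congr fun i => ?_
    rw [ContinuousLinearMap.adjoint_inner_right, norm_inner_symm]
  simp only [h1, h2]
  exact ENNReal.tsum_comm

/-- Polarized form of `hasSum_norm_sq_adjoint`. -/
theorem hasSum_inner_adjoint {e : ι → H} {f : κ → H} (he : IsParseval e) (hf : IsParseval f)
    (A B : H →L[ℂ] H) (hA : Summable fun i => ‖A (e i)‖ ^ 2)
    (hB : Summable fun i => ‖B (e i)‖ ^ 2) :
    ∃ s : ℂ, HasSum (fun i => (inner ℂ (A (e i)) (B (e i)) : ℂ)) s ∧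
      HasSum (fun j => (inner ℂ (ContinuousLinearMap.adjoint B (f j))
        (ContinuousLinearMap.adjoint A (f j)) : ℂ)) s := by
  have key : ∀ c : ℂ, ∃ s : ℝ,
      HasSum (fun i => (‖A (e i) + c • B (e i)‖ : ℂ) ^ 2) (s : ℂ) ∧
      HasSum (fun j => (‖ContinuousLinearMap.adjoint A (f j) +
        (starRingEnd ℂ) c • ContinuousLinearMap.adjoint B (f j)‖ : ℂ) ^ 2) (s : ℂ) := by
    intro c
    have hs : Summable fun i => ‖(A + c • B) (e i)‖ ^ 2 := by
      refine Summable.of_nonneg_of_le (fun i => by positivity) (fun i => ?_)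
        ((hA.mul_left 2).add (hB.mul_left (2 * ‖c‖ ^ 2)))
      have h1 : ‖(A + c • B) (e i)‖ ≤ ‖A (e i)‖ + ‖c‖ * ‖B (e i)‖ := by
        simpa [norm_smul] using norm_add_le (A (e i)) (c • B (e i))
      calc _ ≤ (‖A (e i)‖ + ‖c‖ * ‖B (e i)‖) ^ 2 := by gcongr
        _ ≤ _ := by nlinarith [sq_nonneg (‖A (e i)‖ - ‖c‖ * ‖B (e i)‖)]
    obtain ⟨s, hs⟩ := hs
    refine ⟨s, ?_, ?_⟩
    · simpa using Complex.hasSum_ofReal.2 hs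
    · simpa [← ContinuousLinearMap.star_eq_adjoint] using
        Complex.hasSum_ofReal.2 (hasSum_norm_sq_adjoint he hf _ hs)
  obtain ⟨s₁, h₁, h₁'⟩ := key 1
  obtain ⟨s₂, h₂, h₂'⟩ := key (-1)
  obtain ⟨s₃, h₃, h₃'⟩ := key (-Complex.I)
  obtain ⟨s₄, h₄, h₄'⟩ := key Complex.I
  have rot : ∀ x y : H, ‖x + Complex.I • y‖ = ‖y - Complex.I • x‖ := fun x y => by
    have : x + Complex.I • y = Complex.I • (y - Complex.I • x) := by
      rw [smul_sub, smul_smul, Complex.I_mul_I, neg_one_smul]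
      abel
    rw [this, norm_smul, Complex.norm_I, one_mul]
  refine ⟨((s₁ - s₂) + (s₃ - s₄) * Complex.I) / 4, ?_, ?_⟩
  · refine (((h₁.sub h₂).add ((h₃.sub h₄).mul_right Complex.I)).div_const 4).congr_fun fun i => ?_
    rw [inner_eq_sum_norm_sq_div_four]
    simp [sub_eq_add_neg]
  · refine (((h₁'.sub h₂').add
      ((h₃'.sub h₄').mul_right Complex.I)).div_const 4).congr_fun fun j => ?_
    rw [inner_eq_sum_norm_sq_div_four]
    simp only [map_one, one_smul, map_neg, neg_smul, Complex.conj_I, neg_neg]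
    rw [rot, ← sub_eq_add_neg, ← sub_eq_add_neg, ← rot (ContinuousLinearMap.adjoint B (f j)),
      add_comm (ContinuousLinearMap.adjoint A (f j)) (ContinuousLinearMap.adjoint B (f j)),
      norm_sub_rev (ContinuousLinearMap.adjoint A (f j)), RCLike.I_to_complex]
    rfl

theorem exists_eq_mul_star_of_isPositive {T : H →L[ℂ] H}
    (hT : T.IsPositive) : ∃ b : H →L[ℂ] H, T = b * star b :=
  CStarAlgebra.nonneg_iff_eq_mul_star_self.1 ((ContinuousLinearMap.nonneg_iff_isPositive T).2 hT)

end Parseval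

theorem isParseval_stdBasis : IsParseval stdBasis := isParseval_hilbertBasis _

/-- A density operator is a mixture: there are vectors `φ j`, of total squared length one, such
that `tr (ρ Q) = ∑ ⟨φ j, Q φ j⟩` for all bounded `Q`. The trace may be computed along any Parseval
family. -/
theorem IsState.exists_vectors {ρ : HSpace →L[ℂ] HSpace} (hρ : IsState ρ) :
    ∃ φ : basisIndex → HSpace, HasSum (fun j => ‖φ j‖ ^ 2) 1 ∧
      ∀ Q : HSpace →L[ℂ] HSpace, Summable (fun j => (inner ℂ (φ j) (Q (φ j)) : ℂ)) ∧
        ∀ e : basisIndex → HSpace, IsParseval e →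
          HasSum (fun i => (inner ℂ (e i) (ρ (Q (e i))) : ℂ)) (∑' j, inner ℂ (φ j) (Q (φ j))) := by
  obtain ⟨b, hb⟩ := exists_eq_mul_star_of_isPositive hρ.1
  have hst := isParseval_stdBasis
  have hρ' : ∀ v w, (inner ℂ v (ρ w) : ℂ) = inner ℂ (star b v) (star b w) := fun v w => by
    rw [hb, ContinuousLinearMap.star_eq_adjoint, ContinuousLinearMap.adjoint_inner_left]
    rfl
  have hbs : ContinuousLinearMap.adjoint (star b) = b := by
    rw [ContinuousLinearMap.star_eq_adjoint, ContinuousLinearMap.adjoint_adjoint]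
  have h1 : HasSum (fun i => ‖star b (stdBasis i)‖ ^ 2) 1 := by
    have := Complex.hasSum_re hρ.2
    refine this.congr_fun fun i => ?_
    rw [hρ', inner_self_eq_norm_sq_to_K, ← RCLike.ofReal_pow, RCLike.ofReal_eq_complex_ofReal,
      Complex.ofReal_re]
  have h2 : HasSum (fun j => ‖b (stdBasis j)‖ ^ 2) 1 := by
    have := hasSum_norm_sq_adjoint hst hst _ h1
    rwa [hbs] at this
  have hQ : ∀ Q : HSpace →L[ℂ] HSpace, ∀ e : basisIndex → HSpace, IsParseval e →
      ∃ s : ℂ, HasSum (fun i => (inner ℂ (e i) (ρ (Q (e i))) : ℂ)) s ∧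
      HasSum (fun j => (inner ℂ (b (stdBasis j)) (Q (b (stdBasis j))) : ℂ)) s := by
    intro Q e he
    have hadj : ContinuousLinearMap.adjoint (star b * Q) = ContinuousLinearMap.adjoint Q * b := by
      rw [← ContinuousLinearMap.star_eq_adjoint, star_mul, star_star,
        ContinuousLinearMap.star_eq_adjoint]
    -- `b* Q` is Hilbert-Schmidt because its adjoint `Q* b` is.
    have h4 : Summable fun j => ‖ContinuousLinearMap.adjoint (star b * Q) (stdBasis j)‖ ^ 2 := by
      refine Summable.of_nonneg_of_le (fun i => by positivity) (fun j => ?_)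
        (h2.summable.mul_left (‖ContinuousLinearMap.adjoint Q‖ ^ 2))
      rw [hadj, ← mul_pow]
      gcongr
      exact (ContinuousLinearMap.adjoint Q).le_opNorm _
    have h3 : Summable fun i => ‖(star b * Q) (e i)‖ ^ 2 := by
      have := hasSum_norm_sq_adjoint hst he _ h4.hasSum
      rw [ContinuousLinearMap.adjoint_adjoint] at this
      exact this.summable
    have h5 := hasSum_norm_sq_adjoint hst he _ h2
    obtain ⟨s, hs, hs'⟩ := hasSum_inner_adjoint he hst (star b) (star b * Q) h5.summable h3
    refine ⟨s, hs.congr_fun fun i => hρ' _ _, hs'.congr_fun fun j => ?_⟩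
    rw [hbs, hadj, ← ContinuousLinearMap.adjoint_inner_left]
    rfl
  refine ⟨fun j => b (stdBasis j), h2, fun Q => ⟨?_, fun e he => ?_⟩⟩
  · obtain ⟨s, -, hs⟩ := hQ Q _ hst
    exact hs.summable
  · obtain ⟨s, hs, hs'⟩ := hQ Q e he
    rwa [hs'.tsum_eq]

/-! ### Unitary and antiunitary symmetries -/

/-- A unitary or antiunitary symmetry, presented by its action `conj` on operators, the inverse
`inv` of the underlying map of the Hilbert space, and the automorphism `c` of `ℂ` over which it is
semilinear. The sign `ε` tells how the symmetry acts on one-parameter groups: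
`exp (i t A)` becomes `exp (i ε t A')`, where `A'` is the image of `A`. -/
structure WignerSymmetry where
  c : ℂ →+* ℂ
  ε : ℝ
  c_ε : (c = RingHom.id ℂ ∧ ε = 1) ∨ (c = starRingEnd ℂ ∧ ε = -1)
  inv : HSpace → HSpace
  inv_surjective : Function.Surjective inv
  norm_inv : ∀ v, ‖inv v‖ = ‖v‖
  norm_inner_inv : ∀ v w, ‖(inner ℂ (inv v) (inv w) : ℂ)‖ = ‖(inner ℂ v w : ℂ)‖
  conj : (HSpace →L[ℂ] HSpace) → (HSpace →L[ℂ] HSpace)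
  conj_comp : ∀ S T, conj (S.comp T) = (conj S).comp (conj T)
  inner_conj : ∀ T v, (inner ℂ v (conj T v) : ℂ) = c (inner ℂ (inv v) (T (inv v)))

theorem inner_map_antiunitary (J : HSpace ≃ₗᵢ⋆[ℂ] HSpace) (v w : HSpace) :
    (inner ℂ (J v) (J w) : ℂ) = (starRingEnd ℂ) (inner ℂ v w) := by
  have h1 : J v + (RCLike.I : ℂ) • J w = J (v - (Complex.I) • w) := by
    rw [map_sub, LinearIsometryEquiv.map_smulₛₗ, Complex.conj_I, neg_smul, sub_neg_eq_add]
    rfl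
  have h2 : J v - (RCLike.I : ℂ) • J w = J (v + (Complex.I) • w) := by
    rw [map_add, LinearIsometryEquiv.map_smulₛₗ, Complex.conj_I, neg_smul, ← sub_eq_add_neg]
    rfl
  rw [inner_eq_sum_norm_sq_div_four, inner_eq_sum_norm_sq_div_four, h1, h2, ← map_add, ← map_sub,
    J.norm_map, J.norm_map, J.norm_map, J.norm_map]
  simp only [map_div₀, map_add, map_sub, map_mul, map_pow, RCLike.I_to_complex,
    RCLike.ofReal_eq_complex_ofReal, Complex.conj_ofReal,
    Complex.conj_I, map_ofNat]
  ring

/-- The symmetry given by a unitary. -/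
def WignerSymmetry.ofUnitary (U : HSpace ≃ₗᵢ[ℂ] HSpace) : WignerSymmetry where
  c := RingHom.id ℂ
  ε := 1
  c_ε := Or.inl ⟨rfl, rfl⟩
  inv := U.symm
  inv_surjective := U.symm.surjective
  norm_inv := U.symm.norm_map
  norm_inner_inv v w := by rw [U.symm.inner_map_map]
  conj := conjUnitary U
  conj_comp S T := by
    ext v : 1
    change U (S (T (U.symm v))) = U (S (U.symm (U (T (U.symm v)))))
    rw [U.symm_apply_apply]
  inner_conj T v := by
    change (inner ℂ v (U (T (U.symm v))) : ℂ) = inner ℂ (U.symm v) (T (U.symm v))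
    rw [← U.inner_map_map (U.symm v), U.apply_symm_apply]

/-- The symmetry given by an antiunitary. -/
def WignerSymmetry.ofAntiunitary (J : HSpace ≃ₗᵢ⋆[ℂ] HSpace) : WignerSymmetry where
  c := starRingEnd ℂ
  ε := -1
  c_ε := Or.inr ⟨rfl, rfl⟩
  inv := J.symm
  inv_surjective := J.symm.surjective
  norm_inv := J.symm.norm_map
  norm_inner_inv v w := by
    rw [← RCLike.norm_conj, ← inner_map_antiunitary J, J.apply_symm_apply, J.apply_symm_apply]
  conj := conjAntiunitary J
  conj_comp S T := by
    ext v : 1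
    change J (S (T (J.symm v))) = J (S (J.symm (J (T (J.symm v)))))
    rw [J.symm_apply_apply]
  inner_conj T v := by
    change (inner ℂ v (J (T (J.symm v))) : ℂ) = _
    rw [← inner_map_antiunitary J, J.apply_symm_apply]

namespace WignerSymmetry

variable (S : WignerSymmetry)

theorem c_continuous : Continuous S.c := by
  rcases S.c_ε with ⟨h, -⟩ | ⟨h, -⟩ <;> rw [h]
  · exact continuous_id
  · exact Complex.continuous_conj

theorem c_ofReal (r : ℝ) : S.c r = r := by
  rcases S.c_ε with ⟨h, -⟩ | ⟨h, -⟩ <;> rw [h]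
  · rfl
  · exact Complex.conj_ofReal r

theorem re_c (z : ℂ) : (S.c z).re = z.re := by
  rcases S.c_ε with ⟨h, -⟩ | ⟨h, -⟩ <;> rw [h]
  · rfl
  · exact Complex.conj_re z

theorem c_charFun (μ : Measure ℝ) (t : ℝ) : S.c (charFun μ (S.ε * t)) = charFun μ t := by
  rcases S.c_ε with ⟨h, h'⟩ | ⟨h, h'⟩ <;> rw [h, h']
  · simp
  · rw [neg_one_mul, charFun_neg, Complex.conj_conj]

theorem isParseval_inv {ι : Type*} {e : ι → HSpace} (he : IsParseval e) :
    IsParseval fun i => S.inv (e i) := fun v => by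
  obtain ⟨w, rfl⟩ := S.inv_surjective v
  simp only [S.norm_inner_inv, S.norm_inv]
  exact he w

/-- The vectors `inv (stdBasis i)` form a Parseval family, along which the trace may be computed. -/
theorem hasSum_conj {ρ Q : HSpace →L[ℂ] HSpace} (hρ : IsState ρ) :
    HasSum (fun i => (inner ℂ (stdBasis i) (((S.conj ρ).comp (S.conj Q)) (stdBasis i)) : ℂ))
      (S.c (trace (ρ.comp Q))) := by
  obtain ⟨φ, -, hφ⟩ := hρ.exists_vectors
  have h1 := (hφ Q).2 _ isParseval_stdBasis
  have h2 := (hφ Q).2 _ (S.isParseval_inv isParseval_stdBasis)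
  have h3 : trace (ρ.comp Q) = ∑' j, inner ℂ (φ j) (Q (φ j)) := h1.tsum_eq
  rw [h3]
  refine (h2.map S.c.toAddMonoidHom S.c_continuous).congr_fun fun i => ?_
  rw [← S.conj_comp, S.inner_conj]
  rfl

theorem trace_conj {ρ Q : HSpace →L[ℂ] HSpace} (hρ : IsState ρ) :
    trace ((S.conj ρ).comp (S.conj Q)) = S.c (trace (ρ.comp Q)) :=
  (S.hasSum_conj hρ).tsum_eq

theorem isState_conj {ρ : HSpace →L[ℂ] HSpace} (hρ : IsState ρ) : IsState (S.conj ρ) := by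
  refine ⟨(ContinuousLinearMap.isPositive_iff_complex _).2 fun v => ?_, ?_⟩
  · have h := (ContinuousLinearMap.isPositive_iff_complex _).1 hρ.1 (S.inv v)
    set r : ℝ := RCLike.re (inner ℂ (ρ (S.inv v)) (S.inv v) : ℂ)
    have h1 : (inner ℂ (S.conj ρ v) v : ℂ) = r := by
      rw [← inner_conj_symm, S.inner_conj, ← inner_conj_symm, ← h.1]
      simp only [Complex.conj_ofReal, S.c_ofReal]
    rw [h1]
    exact ⟨by simp, by simpa using h.2⟩
  · have h1 := S.hasSum_conj (Q := 1) hρ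
    have h2 : trace (ρ.comp (1 : HSpace →L[ℂ] HSpace)) = 1 := by
      exact hρ.2.tsum_eq
    rw [h2, map_one, ← S.conj_comp] at h1
    exact h1

end WignerSymmetry

/-- The states in which the projection `Q` has expectation one. -/
def statesIn (Q : HSpace →L[ℂ] HSpace) : Set (HSpace →L[ℂ] HSpace) :=
  {ρ | IsState ρ ∧ trace (ρ.comp Q) = 1}

namespace WignerSymmetry

theorem mapsTo_statesIn (S : WignerSymmetry) (Q : HSpace →L[ℂ] HSpace) :
    Set.MapsTo S.conj (statesIn Q) (statesIn (S.conj Q)) := fun ρ hρ =>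
  ⟨S.isState_conj hρ.1, by rw [S.trace_conj hρ.1, hρ.2, map_one]⟩

theorem image_statesIn (S S' : WignerSymmetry) (h : ∀ T, S.conj (S'.conj T) = T)
    (h' : ∀ T, S'.conj (S.conj T) = T) (Q : HSpace →L[ℂ] HSpace) :
    S.conj '' statesIn Q = statesIn (S.conj Q) := by
  refine (S.mapsTo_statesIn Q).image_subset.antisymm fun ρ hρ => ⟨S'.conj ρ, ?_, h ρ⟩
  have := S'.mapsTo_statesIn _ hρ
  rwa [h'] at this

theorem values_eq (S : WignerSymmetry) {p q : Problem} (hp : ∀ ρ ∈ p.states, IsState ρ)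
    (hs : S.conj '' p.states = q.states) (ho : S.conj p.op = q.op) : p.values = q.values := by
  have key : ∀ ρ ∈ p.states,
      (trace ((S.conj ρ).comp q.op)).re = (trace (ρ.comp p.op)).re := fun ρ hρ => by
    rw [← ho, S.trace_conj (hp ρ hρ), S.re_c]
  ext v
  constructor
  · rintro ⟨ρ, hρ, rfl⟩
    exact ⟨S.conj ρ, hs ▸ Set.mem_image_of_mem _ hρ, key ρ hρ⟩
  · rintro ⟨ρ', hρ', rfl⟩
    rw [← hs] at hρ'
    obtain ⟨ρ, hρ, rfl⟩ := hρ'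
    exact ⟨ρ, hρ, (key ρ hρ).symm⟩

/-- A symmetry that carries the group generated by `A` to that generated by `A'` carries `f(A)` to
`f(A')`. -/
theorem conj_functionOf (S : WignerSymmetry) {A A' : Affine}
    (h : ∀ t, S.conj (expGroup A t) = expGroup A' (S.ε * t)) {f : ℝ → ℝ} (hf : Measurable f)
    (hb : ∃ C : ℝ, ∀ x, |f x| ≤ C) : S.conj (functionOf f A) = functionOf f A' := by
  refine IsFunctionOf.unique (A := A') (f := f) (fun ψ => ?_) (isFunctionOf_functionOf A' f hf hb)
  obtain ⟨μ, hμ, hc, hQ⟩ := isFunctionOf_functionOf A f hf hb (S.inv ψ)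
  have hε : S.ε * S.ε = 1 := by rcases S.c_ε with ⟨-, h⟩ | ⟨-, h⟩ <;> norm_num [h]
  refine ⟨μ, hμ, fun t => ?_, ?_⟩
  · rw [← S.c_charFun, hc, ← S.inner_conj, h, ← mul_assoc, hε, one_mul]
  · rw [S.inner_conj, hQ, S.c_ofReal]

end WignerSymmetry

/-! ### Spectral projections -/

theorem measurable_indicator_one {R : Set ℝ} (hR : MeasurableSet R) :
    Measurable (R.indicator fun _ => (1 : ℝ)) :=
  measurable_const.indicator hR

theorem bounded_indicator_one (R : Set ℝ) :
    ∃ C : ℝ, ∀ x, |R.indicator (fun _ => (1 : ℝ)) x| ≤ C := by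
  classical
  refine ⟨1, fun x => ?_⟩
  by_cases h : x ∈ R <;> simp [h]

theorem WignerSymmetry.conj_spectralProj (S : WignerSymmetry) {A A' : Affine}
    (h : ∀ t, S.conj (expGroup A t) = expGroup A' (S.ε * t)) {R : Set ℝ} (hR : MeasurableSet R) :
    S.conj (spectralProj R A) = spectralProj R A' :=
  S.conj_functionOf h (measurable_indicator_one hR) (bounded_indicator_one R)

theorem expGroup_coeFn (A : Affine) (t : ℝ) (ψ : HSpace) :
    (expGroup A t ψ : ℝ → ℂ) =ᵐ[volume] fun x =>
      Complex.exp (((t * A.a * x + t ^ 2 * A.a * A.b / 2 + t * A.c : ℝ) : ℂ) * Complex.I) *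
        ψ (x + t * A.b) := by
  unfold expGroup
  rw [ContinuousLinearMap.comp_apply]
  filter_upwards [mulOp_coeFn (fun x : ℝ =>
    Complex.exp (((t * A.a * x + t ^ 2 * A.a * A.b / 2 + t * A.c : ℝ) : ℂ) * Complex.I))
    (by fun_prop) ⟨1, fun x => (Complex.norm_exp_ofReal_mul_I _).le⟩ (translate (t * A.b) ψ),
    translate_coeFn (t * A.b) ψ] with x h1 h2
  rw [h1, h2]

theorem phase_mul_phase_mul (r s : ℝ) (z : ℂ) :
    Complex.exp ((r : ℂ) * Complex.I) * (Complex.exp ((s : ℂ) * Complex.I) * z) =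
      Complex.exp (((r + s : ℝ) : ℂ) * Complex.I) * z := by
  rw [← mul_assoc, ← Complex.exp_add, ← add_mul, ← Complex.ofReal_add]

theorem phase_mul_congr {r s : ℝ} {z w : ℂ} (h : r = s) (h' : z = w) :
    Complex.exp ((r : ℂ) * Complex.I) * z = Complex.exp ((s : ℂ) * Complex.I) * w := by
  rw [h, h']

theorem expGroup_rescale (A : Affine) (k d t : ℝ) (ψ : HSpace) :
    expGroup ⟨k * A.a, k * A.b, k * A.c + d⟩ t ψ =
      Complex.exp (((t * d : ℝ) : ℂ) * Complex.I) • expGroup A (k * t) ψ := by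
  refine Lp.ext ?_
  filter_upwards [expGroup_coeFn ⟨k * A.a, k * A.b, k * A.c + d⟩ t ψ, expGroup_coeFn A (k * t) ψ,
    Lp.coeFn_smul (Complex.exp (((t * d : ℝ) : ℂ) * Complex.I)) (expGroup A (k * t) ψ)]
    with x h1 h2 h3
  rw [h1, h3, Pi.smul_apply, h2, smul_eq_mul, phase_mul_phase_mul]
  exact phase_mul_congr (by ring) (by ring_nf)

/-- `1_R(k A + d) = 1_{R'}(A)`, where `R'` is the preimage of `R` under `s ↦ k s + d`. -/
theorem spectralProj_rescale (A : Affine) (k d : ℝ) {R : Set ℝ} (hR : MeasurableSet R) :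
    spectralProj R ⟨k * A.a, k * A.b, k * A.c + d⟩ =
      spectralProj ((fun s => k * s + d) ⁻¹' R) A := by
  have hm : Measurable fun s : ℝ => k * s + d := by fun_prop
  refine (IsFunctionOf.unique (fun ψ => ?_) (isFunctionOf_functionOf _ _
    (measurable_indicator_one hR) (bounded_indicator_one R))).symm
  obtain ⟨μ, hμ, hc, hQ⟩ := isFunctionOf_functionOf A _ (measurable_indicator_one (hm hR))
    (bounded_indicator_one _) ψ
  refine ⟨μ.map fun s => k * s + d, Measure.isFiniteMeasure_map _ _, fun t => ?_, ?_⟩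
  · rw [expGroup_rescale, inner_smul_right, ← hc, charFun_apply_real, charFun_apply_real,
      integral_map hm.aemeasurable (by fun_prop), ← integral_const_mul]
    refine integral_congr_ae (Eventually.of_forall fun s => ?_)
    simp only
    rw [← Complex.exp_add]
    congr 1
    push_cast
    ring
  · rw [integral_map hm.aemeasurable (measurable_indicator_one hR).aestronglyMeasurable]
    exact hQ

/-- `Θ(k A) = Θ(A)` for `k > 0`. -/
theorem heaviside_rescale {A A' : Affine} (k : ℝ) (hk : 0 < k) (ha : A'.a = k * A.a)
    (hb : A'.b = k * A.b) (hc : A'.c = k * A.c) : heaviside A' = heaviside A := by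
  have h : A' = ⟨k * A.a, k * A.b, k * A.c + 0⟩ := by ext <;> simp [ha, hb, hc]
  unfold heaviside
  rw [h, spectralProj_rescale _ _ _ measurableSet_Ici]
  congr 1
  ext s
  simp [hk]

/-! ### Generators of the metaplectic group and complex conjugation -/

theorem map_volume_affine {k : ℝ} (hk : 0 < k) (m : ℝ) :
    (volume : Measure ℝ).map (fun x => k * x + m) = ENNReal.ofReal k⁻¹ • volume := by
  have h : (fun x : ℝ => k * x + m) = (fun x => x + m) ∘ fun x => k * x := rfl
  rw [h, ← Measure.map_map (by fun_prop) (by fun_prop), Real.map_volume_mul_left hk.ne',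
    Measure.map_smul, map_add_right_eq_self, abs_of_pos (inv_pos.2 hk)]

theorem quasiMeasurePreserving_affine {k : ℝ} (hk : 0 < k) (m : ℝ) :
    Measure.QuasiMeasurePreserving (fun x : ℝ => k * x + m) volume volume :=
  ⟨by fun_prop, by
    rw [map_volume_affine hk]
    exact Measure.smul_absolutelyContinuous⟩

theorem aestronglyMeasurable_substPhase {k : ℝ} (hk : 0 < k) (m : ℝ) {q : ℝ → ℝ}
    (hq : Measurable q) (ψ : HSpace) :
    AEStronglyMeasurable (fun x : ℝ => Complex.exp ((q x : ℂ) * Complex.I) *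
      ((√k : ℂ) * ψ (k * x + m))) volume :=
  (by fun_prop :
    Measurable fun x : ℝ => Complex.exp ((q x : ℂ) * Complex.I)).aestronglyMeasurable.mul
    (((Lp.aestronglyMeasurable ψ).comp_quasiMeasurePreserving
      (quasiMeasurePreserving_affine hk m)).const_mul _)

theorem eLpNorm_substPhase {k : ℝ} (hk : 0 < k) (m : ℝ) (q : ℝ → ℝ) (ψ : HSpace) :
    eLpNorm (fun x : ℝ => Complex.exp ((q x : ℂ) * Complex.I) * ((√k : ℂ) * ψ (k * x + m))) 2
      volume = eLpNorm ψ 2 volume := by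
  have h1 : eLpNorm (fun x : ℝ => Complex.exp ((q x : ℂ) * Complex.I) *
      ((√k : ℂ) * ψ (k * x + m))) 2 volume =
      eLpNorm ((√k : ℂ) • ((ψ : ℝ → ℂ) ∘ fun x => k * x + m)) 2 volume := by
    refine eLpNorm_congr_norm_ae (Eventually.of_forall fun x => ?_)
    rw [norm_mul, Complex.norm_exp_ofReal_mul_I, one_mul]
    rfl
  have hm : AEStronglyMeasurable (ψ : ℝ → ℂ) ((volume : Measure ℝ).map fun x => k * x + m) := by
    rw [map_volume_affine hk]
    exact (Lp.aestronglyMeasurable ψ).smul_measure _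
  rw [h1, eLpNorm_const_smul, ← eLpNorm_map_measure hm (by fun_prop), map_volume_affine hk,
    eLpNorm_smul_measure_of_ne_top (by norm_num), smul_eq_mul, ← mul_assoc]
  have h2 : ‖(√k : ℂ)‖ₑ * ENNReal.ofReal k⁻¹ ^ (1 / (2 : ENNReal)).toReal = 1 := by
    rw [← ofReal_norm, Complex.norm_real, Real.norm_of_nonneg (Real.sqrt_nonneg k),
      ENNReal.ofReal_rpow_of_pos (inv_pos.2 hk), ← ENNReal.ofReal_mul (Real.sqrt_nonneg k)]
    have : (1 / (2 : ENNReal)).toReal = 1 / 2 := by simp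
    rw [this, ← Real.sqrt_eq_rpow, ← Real.sqrt_mul hk.le, mul_inv_cancel₀ hk.ne', Real.sqrt_one,
      ENNReal.ofReal_one]
  rw [h2, one_mul]

theorem memLp_substPhase {k : ℝ} (hk : 0 < k) (m : ℝ) {q : ℝ → ℝ} (hq : Measurable q)
    (ψ : HSpace) : MemLp (fun x : ℝ => Complex.exp ((q x : ℂ) * Complex.I) *
      ((√k : ℂ) * ψ (k * x + m))) 2 volume :=
  ⟨aestronglyMeasurable_substPhase hk m hq ψ,
    (eLpNorm_substPhase hk m q ψ).trans_lt (Lp.eLpNorm_lt_top ψ)⟩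

/-- The isometry `ψ ↦ √k exp (i q(x)) ψ(k x + m)`. -/
def substPhase {k : ℝ} (hk : 0 < k) (m : ℝ) {q : ℝ → ℝ} (hq : Measurable q) :
    HSpace →ₗᵢ[ℂ] HSpace where
  toFun ψ := (memLp_substPhase hk m hq ψ).toLp _
  map_add' ψ χ := by
    rw [← MemLp.toLp_add]
    refine MemLp.toLp_congr _ _ ?_
    filter_upwards [(quasiMeasurePreserving_affine hk m).ae_eq_comp (Lp.coeFn_add ψ χ)] with x hx
    simp only [Function.comp_apply, Pi.add_apply] at hx ⊢
    rw [hx]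
    ring
  map_smul' r ψ := by
    rw [RingHom.id_apply, ← MemLp.toLp_const_smul]
    refine MemLp.toLp_congr _ _ ?_
    filter_upwards [(quasiMeasurePreserving_affine hk m).ae_eq_comp (Lp.coeFn_smul r ψ)] with x hx
    simp only [Function.comp_apply, Pi.smul_apply, smul_eq_mul] at hx ⊢
    rw [hx]
    ring
  norm_map' ψ := by
    rw [LinearMap.coe_mk, AddHom.coe_mk, Lp.norm_toLp, eLpNorm_substPhase hk m q, Lp.norm_def]

theorem substPhase_coeFn {k : ℝ} (hk : 0 < k) (m : ℝ) {q : ℝ → ℝ} (hq : Measurable q)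
    (ψ : HSpace) : (substPhase hk m hq ψ : ℝ → ℂ) =ᵐ[volume] fun x : ℝ =>
      Complex.exp ((q x : ℂ) * Complex.I) * ((√k : ℂ) * ψ (k * x + m)) :=
  MemLp.coeFn_toLp (memLp_substPhase hk m hq ψ)

theorem substPhase_surjective {k : ℝ} (hk : 0 < k) (m : ℝ) {q : ℝ → ℝ} (hq : Measurable q) :
    Function.Surjective (substPhase hk m hq) := fun χ => by
  have hq' : Measurable fun x => -q (k⁻¹ * x + -(k⁻¹ * m)) := by fun_prop
  refine ⟨substPhase (inv_pos.2 hk) (-(k⁻¹ * m)) hq' χ, Lp.ext ?_⟩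
  filter_upwards [substPhase_coeFn hk m hq (substPhase (inv_pos.2 hk) (-(k⁻¹ * m)) hq' χ),
    (quasiMeasurePreserving_affine hk m).ae_eq_comp
      (substPhase_coeFn (inv_pos.2 hk) (-(k⁻¹ * m)) hq' χ)] with x h1 h2
  have hx : k⁻¹ * (k * x + m) + -(k⁻¹ * m) = x := by
    field_simp
    ring
  have hs : (√k : ℂ) * (√k⁻¹ : ℂ) = 1 := by
    rw [← Complex.ofReal_mul, ← Real.sqrt_mul hk.le, mul_inv_cancel₀ hk.ne', Real.sqrt_one,
      Complex.ofReal_one]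
  simp only [Function.comp_apply, hx] at h2
  rw [h1, h2, mul_left_comm (√k : ℂ), phase_mul_phase_mul, ← mul_assoc (√k : ℂ), hs]
  simp

/-- The unitary `ψ ↦ √k exp (i q(x)) ψ(k x + m)`. -/
def substPhaseEquiv {k : ℝ} (hk : 0 < k) (m : ℝ) {q : ℝ → ℝ} (hq : Measurable q) :
    HSpace ≃ₗᵢ[ℂ] HSpace :=
  LinearIsometryEquiv.ofSurjective (substPhase hk m hq) (substPhase_surjective hk m hq)

/-- `U` carries the group generated by `A` to that generated by `A ∘ σ`, with time running in the
direction given by the sign `ε`. -/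
def Implements (U : HSpace → HSpace) (ε : ℝ) (σ : AffineMap2) : Prop :=
  ∀ A t ψ, U (expGroup A t ψ) = expGroup (A.comp σ) (ε * t) (U ψ)

theorem Implements.comp {U V : HSpace → HSpace} {ε ε' : ℝ} {σ τ υ : AffineMap2}
    (hU : Implements U ε σ) (hV : Implements V ε' τ)
    (h : ∀ A : Affine, (A.comp τ).comp σ = A.comp υ) :
    Implements (fun ψ => U (V ψ)) (ε * ε') υ := fun A t ψ => by
  simp only
  rw [hV, hU, h, mul_assoc]

/-- The unitary `ψ ↦ √k exp (i (q₂ x² / 2 + q₁ x)) ψ(k x + m)` transforms `X` into `k X + m` and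
`P` into `(P - q₂ X - q₁) / k`. -/
theorem implements_substPhaseEquiv {k : ℝ} (hk : 0 < k) (m q₁ q₂ : ℝ) :
    Implements (substPhaseEquiv hk m (q := fun x => q₂ * x ^ 2 / 2 + q₁ * x) (by fun_prop)) 1
      ⟨⟨k, 0, m⟩, ⟨-(q₂ / k), k⁻¹, -(q₁ / k)⟩⟩ := fun A t ψ => by
  refine Lp.ext ?_
  have hq : Measurable fun x : ℝ => q₂ * x ^ 2 / 2 + q₁ * x := by fun_prop
  change (substPhase hk m hq (expGroup A t ψ) : ℝ → ℂ) =ᵐ[volume]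
    (expGroup _ _ (substPhase hk m hq ψ) : ℝ → ℂ)
  rw [one_mul]
  filter_upwards [substPhase_coeFn hk m hq (expGroup A t ψ),
    (quasiMeasurePreserving_affine hk m).ae_eq_comp (expGroup_coeFn A t ψ),
    expGroup_coeFn (A.comp ⟨⟨k, 0, m⟩, ⟨-(q₂ / k), k⁻¹, -(q₁ / k)⟩⟩) t (substPhase hk m hq ψ),
    (measurePreserving_add_right volume _).quasiMeasurePreserving.ae_eq_comp
      (substPhase_coeFn hk m hq ψ)] with x h1 h2 h3 h4
  simp only [Function.comp_apply] at h2 h4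
  rw [h1, h2, h3, h4, mul_left_comm (√k : ℂ), phase_mul_phase_mul, phase_mul_phase_mul]
  simp only [Affine.comp, mul_zero, zero_add]
  refine phase_mul_congr ?_ ?_
  · field_simp
    ring
  · refine congrArg (fun y => (√k : ℂ) * ψ y) ?_
    field_simp
    ring

theorem conj_coeFn (ψ : HSpace) :
    ((star ψ : HSpace) : ℝ → ℂ) =ᵐ[volume] fun x => (starRingEnd ℂ) (ψ x) :=
  Lp.coeFn_star ψ

/-- Complex conjugation. -/
def complexConj : HSpace ≃ₗᵢ⋆[ℂ] HSpace where
  toFun := star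
  invFun := star
  left_inv := star_star
  right_inv := star_star
  map_add' ψ χ := by
    refine Lp.ext ?_
    filter_upwards [conj_coeFn (ψ + χ), conj_coeFn ψ, conj_coeFn χ, Lp.coeFn_add ψ χ,
      Lp.coeFn_add (star ψ) (star χ)] with x h1 h2 h3 h4 h5
    rw [h1, h5, h4, Pi.add_apply, Pi.add_apply, h2, h3, map_add]
  map_smul' r ψ := by
    refine Lp.ext ?_
    filter_upwards [conj_coeFn (r • ψ), conj_coeFn ψ, Lp.coeFn_smul r ψ,
      Lp.coeFn_smul ((starRingEnd ℂ) r) (star ψ)] with x h1 h2 h3 h4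
    rw [h1, h4, h3, Pi.smul_apply, Pi.smul_apply, h2, smul_eq_mul, smul_eq_mul, map_mul]
  norm_map' ψ := by
    change ‖(star ψ : HSpace)‖ = ‖ψ‖
    rw [Lp.norm_def, Lp.norm_def]
    congr 1
    refine eLpNorm_congr_norm_ae ?_
    filter_upwards [conj_coeFn ψ] with x hx
    rw [hx, RCLike.norm_conj]

/-- Complex conjugation fixes `X` and reverses `P`. -/
theorem implements_complexConj :
    Implements complexConj (-1) ⟨⟨1, 0, 0⟩, ⟨0, -1, 0⟩⟩ := fun A t ψ => by
  refine Lp.ext ?_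
  change ((star (expGroup A t ψ) : HSpace) : ℝ → ℂ) =ᵐ[volume]
    (expGroup _ _ (star ψ : HSpace) : ℝ → ℂ)
  filter_upwards [conj_coeFn (expGroup A t ψ), expGroup_coeFn A t ψ,
    expGroup_coeFn (A.comp ⟨⟨1, 0, 0⟩, ⟨0, -1, 0⟩⟩) (-1 * t) (star ψ),
    (measurePreserving_add_right volume _).quasiMeasurePreserving.ae_eq_comp
      (conj_coeFn ψ)] with x h1 h2 h3 h4
  simp only [Function.comp_apply] at h4
  rw [h1, h2, h3, h4, map_mul, ← Complex.exp_conj, map_mul, Complex.conj_I, Complex.conj_ofReal,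
    mul_neg, ← neg_mul, ← Complex.ofReal_neg]
  simp only [Affine.comp]
  refine phase_mul_congr (by ring) ?_
  congr 2
  ring

/-- The inverse Fourier transform turns translations into modulations. -/
theorem fourier_symm_translate (s : ℝ) (ψ : HSpace) :
    (Lp.fourierTransformₗᵢ ℝ ℂ).symm (translate s ψ) =
      mulOp (fun ξ : ℝ => Complex.exp (((-(2 * Real.pi * s * ξ) : ℝ) : ℂ) * Complex.I))
        (by fun_prop) ⟨1, fun x => (Complex.norm_exp_ofReal_mul_I _).le⟩
        ((Lp.fourierTransformₗᵢ ℝ ℂ).symm ψ) := by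
  refine DenseRange.induction_on
    (p := fun ψ : HSpace => (Lp.fourierTransformₗᵢ ℝ ℂ).symm (translate s ψ) =
      mulOp (fun ξ : ℝ => Complex.exp (((-(2 * Real.pi * s * ξ) : ℝ) : ℂ) * Complex.I))
        (by fun_prop) ⟨1, fun x => (Complex.norm_exp_ofReal_mul_I _).le⟩
        ((Lp.fourierTransformₗᵢ ℝ ℂ).symm ψ))
    (SchwartzMap.denseRange_toLpCLM (p := 2) ENNReal.ofNat_ne_top) ψ ?_ ?_
  · exact isClosed_eq ((LinearIsometryEquiv.continuous _).comp (translate s).continuous)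
      ((ContinuousLinearMap.continuous _).comp (LinearIsometryEquiv.continuous _))
  · intro f
    have h1 : translate s (f.toLp 2) = (f.compSubConstCLM ℝ (-s)).toLp 2 := by
      refine Lp.ext ?_
      filter_upwards [translate_coeFn s (f.toLp 2),
        (measurePreserving_add_right volume s).quasiMeasurePreserving.ae_eq_comp (f.coeFn_toLp 2),
        (f.compSubConstCLM ℝ (-s)).coeFn_toLp 2] with x h1 h2 h3
      simp only [Function.comp_apply] at h2
      rw [h1, h2, h3, SchwartzMap.compSubConstCLM_apply, sub_neg_eq_add]
    change (Lp.fourierTransformₗᵢ ℝ ℂ).symm (translate s (f.toLp 2)) = mulOp _ _ _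
      ((Lp.fourierTransformₗᵢ ℝ ℂ).symm (f.toLp 2))
    have h2 : ∀ g : SchwartzMap ℝ ℂ, (Lp.fourierTransformₗᵢ ℝ ℂ).symm (g.toLp 2) =
        (FourierTransformInv.fourierInv g : SchwartzMap ℝ ℂ).toLp 2 :=
      SchwartzMap.toLp_fourierInv_eq
    rw [h1, h2, h2]
    refine Lp.ext ?_
    filter_upwards [(FourierTransformInv.fourierInv f : SchwartzMap ℝ ℂ).coeFn_toLp 2,
      (FourierTransformInv.fourierInv (f.compSubConstCLM ℝ (-s)) : SchwartzMap ℝ ℂ).coeFn_toLp 2,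
      mulOp_coeFn (fun ξ : ℝ => Complex.exp (((-(2 * Real.pi * s * ξ) : ℝ) : ℂ) * Complex.I))
        (by fun_prop) ⟨1, fun x => (Complex.norm_exp_ofReal_mul_I _).le⟩
        ((FourierTransformInv.fourierInv f : SchwartzMap ℝ ℂ).toLp 2)] with ξ h3 h4 h5
    rw [h4, h5, h3]
    rw [SchwartzMap.fourierInv_coe, SchwartzMap.fourierInv_coe, Real.fourierInv_eq',
      Real.fourierInv_eq', ← integral_add_right_eq_self _ (-s), ← integral_const_mul]
    refine integral_congr_ae (Eventually.of_forall fun x => ?_)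
    simp only [SchwartzMap.compSubConstCLM_apply, smul_eq_mul]
    rw [← mul_assoc, ← Complex.exp_add]
    congr 2
    · simp
      ring
    · simp

/-- The Fourier transform turns modulations into translations. -/
theorem fourier_modulate (s : ℝ) (ψ : HSpace) :
    Lp.fourierTransformₗᵢ ℝ ℂ
      (mulOp (fun x : ℝ => Complex.exp (((-(2 * Real.pi * s * x) : ℝ) : ℂ) * Complex.I))
        (by fun_prop) ⟨1, fun x => (Complex.norm_exp_ofReal_mul_I _).le⟩ ψ) =
      translate s (Lp.fourierTransformₗᵢ ℝ ℂ ψ) := by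
  have h := fourier_symm_translate s (Lp.fourierTransformₗᵢ ℝ ℂ ψ)
  rw [LinearIsometryEquiv.symm_apply_apply] at h
  rw [← h, LinearIsometryEquiv.apply_symm_apply]

/-- The Fourier transform, normalized with kernel `exp (-2 π i x ξ)`, transforms `X` into
`-P / (2 π)` and `P` into `2 π X`. -/
theorem implements_fourier :
    Implements (Lp.fourierTransformₗᵢ ℝ ℂ) 1
      ⟨⟨0, -(2 * Real.pi)⁻¹, 0⟩, ⟨2 * Real.pi, 0, 0⟩⟩ := fun A t ψ => by
  have hpi := Real.pi_pos
  set s : ℝ := -(t * A.a / (2 * Real.pi)) with hs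
  set r : ℝ := t ^ 2 * A.a * A.b / 2 + t * A.c with hr
  have h1 : expGroup A t ψ = Complex.exp ((r : ℂ) * Complex.I) •
      mulOp (fun x : ℝ => Complex.exp (((-(2 * Real.pi * s * x) : ℝ) : ℂ) * Complex.I))
        (by fun_prop) ⟨1, fun x => (Complex.norm_exp_ofReal_mul_I _).le⟩
        (translate (t * A.b) ψ) := by
    refine Lp.ext ?_
    filter_upwards [expGroup_coeFn A t ψ, Lp.coeFn_smul (Complex.exp ((r : ℂ) * Complex.I))
      (mulOp (fun x : ℝ => Complex.exp (((-(2 * Real.pi * s * x) : ℝ) : ℂ) * Complex.I))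
        (by fun_prop) ⟨1, fun x => (Complex.norm_exp_ofReal_mul_I _).le⟩
        (translate (t * A.b) ψ)),
      mulOp_coeFn (fun x : ℝ => Complex.exp (((-(2 * Real.pi * s * x) : ℝ) : ℂ) * Complex.I))
        (by fun_prop) ⟨1, fun x => (Complex.norm_exp_ofReal_mul_I _).le⟩
        (translate (t * A.b) ψ), translate_coeFn (t * A.b) ψ] with x h1 h2 h3 h4
    rw [h1, h2, Pi.smul_apply, h3, h4, smul_eq_mul, phase_mul_phase_mul]
    refine phase_mul_congr ?_ rfl
    rw [hs, hr]
    field_simp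
    ring
  rw [h1, LinearIsometryEquiv.map_smul, fourier_modulate, fourier_translate, one_mul]
  refine Lp.ext ?_
  set χ := Lp.fourierTransformₗᵢ ℝ ℂ ψ
  filter_upwards [expGroup_coeFn (A.comp ⟨⟨0, -(2 * Real.pi)⁻¹, 0⟩, ⟨2 * Real.pi, 0, 0⟩⟩) t χ,
    Lp.coeFn_smul (Complex.exp ((r : ℂ) * Complex.I)) (translate s
      (mulOp (fun ξ : ℝ => Complex.exp (((2 * Real.pi * (t * A.b) * ξ : ℝ) : ℂ) * Complex.I))
        (by fun_prop) ⟨1, fun x => (Complex.norm_exp_ofReal_mul_I _).le⟩ χ)),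
    translate_coeFn s
      (mulOp (fun ξ : ℝ => Complex.exp (((2 * Real.pi * (t * A.b) * ξ : ℝ) : ℂ) * Complex.I))
        (by fun_prop) ⟨1, fun x => (Complex.norm_exp_ofReal_mul_I _).le⟩ χ),
    (measurePreserving_add_right volume s).quasiMeasurePreserving.ae_eq_comp
      (mulOp_coeFn (fun ξ : ℝ =>
        Complex.exp (((2 * Real.pi * (t * A.b) * ξ : ℝ) : ℂ) * Complex.I))
        (by fun_prop) ⟨1, fun x => (Complex.norm_exp_ofReal_mul_I _).le⟩ χ)] with ξ h2 h3 h4 h5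
  simp only [Function.comp_apply] at h5
  rw [h2, h3, Pi.smul_apply, h4, h5, smul_eq_mul, phase_mul_phase_mul]
  simp only [Affine.comp]
  refine phase_mul_congr ?_ ?_
  · rw [hs, hr]
    field_simp
    ring
  · congr 1
    rw [hs]
    field_simp
    ring

/-! ### Position distributions -/

theorem integrable_norm_sq (ψ : HSpace) : Integrable (fun x => ‖ψ x‖ ^ 2) (volume : Measure ℝ) :=
  (memLp_two_iff_integrable_sq_norm (Lp.aestronglyMeasurable _)).1 (Lp.memLp ψ)

/-- The unnormalized probability of finding a particle with wave function `ψ` in `R`. -/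
def positionProb (R : Set ℝ) (ψ : HSpace) : ℝ := ∫ x in R, ‖ψ x‖ ^ 2

theorem norm_sq_eq_integral (ψ : HSpace) : ‖ψ‖ ^ 2 = ∫ x, ‖ψ x‖ ^ 2 := by
  have h : (inner ℂ ψ ψ : ℂ) = ((∫ x, ‖ψ x‖ ^ 2 : ℝ) : ℂ) := by
    rw [L2.inner_def, ← integral_complex_ofReal]
    refine integral_congr_ae (Eventually.of_forall fun x => ?_)
    simp only [inner_self_eq_norm_sq_to_K, RCLike.ofReal_eq_complex_ofReal, Complex.ofReal_pow]
  rw [inner_self_eq_norm_sq_to_K, RCLike.ofReal_eq_complex_ofReal] at h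
  exact_mod_cast h

theorem positionProb_le (R : Set ℝ) (ψ : HSpace) : positionProb R ψ ≤ ‖ψ‖ ^ 2 := by
  rw [norm_sq_eq_integral]
  exact setIntegral_le_integral (integrable_norm_sq ψ) (Eventually.of_forall fun x => by positivity)

theorem positionProb_mono {R R' : Set ℝ} (h : R ⊆ R') (ψ : HSpace) :
    positionProb R ψ ≤ positionProb R' ψ :=
  setIntegral_mono_set (integrable_norm_sq ψ).integrableOn
    (Eventually.of_forall fun x => by positivity) h.eventuallyLE

theorem inner_spectralProj_posX {R : Set ℝ} (hR : MeasurableSet R) (ψ : HSpace) :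
    (inner ℂ ψ (spectralProj R posX ψ) : ℂ) = positionProb R ψ := by
  obtain ⟨μ, hμ, hc, hQ⟩ := isFunctionOf_functionOf posX _ (measurable_indicator_one hR)
    (bounded_indicator_one R) ψ
  have hint := integrable_norm_sq ψ
  have hae : AEMeasurable (fun x => ENNReal.ofReal (‖ψ x‖ ^ 2)) (volume : Measure ℝ) :=
    hint.aestronglyMeasurable.aemeasurable.ennreal_ofReal
  have hfin : IsFiniteMeasure
      ((volume : Measure ℝ).withDensity fun x => ENNReal.ofReal (‖ψ x‖ ^ 2)) :=
    isFiniteMeasure_withDensity_ofReal hint.2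
  -- `exp (i t X)` is multiplication by `exp (i t x)`, so the spectral distribution is `|ψ|² dx`.
  have hμ' : μ = (volume : Measure ℝ).withDensity fun x => ENNReal.ofReal (‖ψ x‖ ^ 2) := by
    refine Measure.ext_of_charFun (funext fun t => ?_)
    rw [hc, charFun_apply_real, integral_withDensity_eq_integral_toReal_smul₀ hae
      (Eventually.of_forall fun _ => ENNReal.ofReal_lt_top), L2.inner_def]
    refine integral_congr_ae ?_
    filter_upwards [expGroup_coeFn posX t ψ] with x hx
    rw [hx, ENNReal.toReal_ofReal (by positivity)]
    simp only [posX, mul_one, mul_zero, add_zero, zero_div]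
    rw [← smul_eq_mul (a := Complex.exp _), inner_smul_right, inner_self_eq_norm_sq_to_K,
      Complex.real_smul, mul_comm]
    push_cast
    rfl
  have h2 : ∫ s, R.indicator (fun _ => (1 : ℝ)) s ∂μ = positionProb R ψ := by
    rw [hμ', integral_withDensity_eq_integral_toReal_smul₀ hae
      (Eventually.of_forall fun _ => ENNReal.ofReal_lt_top), positionProb,
      ← integral_indicator hR]
    refine integral_congr_ae (Eventually.of_forall fun x => ?_)
    by_cases hx : x ∈ R
    · simp [hx]
    · simp [hx]
  rw [← h2]
  exact hQ

theorem memLp_indicator {R : Set ℝ} (hR : MeasurableSet R) (ψ : HSpace) :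
    MemLp (R.indicator (ψ : ℝ → ℂ)) 2 (volume : Measure ℝ) :=
  (Lp.memLp ψ).indicator hR

/-- The restriction of a wave function to `R`. -/
def truncate {R : Set ℝ} (hR : MeasurableSet R) (ψ : HSpace) : HSpace :=
  (memLp_indicator hR ψ).toLp _

theorem truncate_coeFn {R : Set ℝ} (hR : MeasurableSet R) (ψ : HSpace) :
    (truncate hR ψ : ℝ → ℂ) =ᵐ[volume] R.indicator (ψ : ℝ → ℂ) :=
  MemLp.coeFn_toLp (memLp_indicator hR ψ)

theorem norm_sq_truncate {R : Set ℝ} (hR : MeasurableSet R) (ψ : HSpace) :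
    ‖truncate hR ψ‖ ^ 2 = positionProb R ψ := by
  rw [norm_sq_eq_integral, positionProb, ← integral_indicator hR]
  refine integral_congr_ae ?_
  filter_upwards [truncate_coeFn hR ψ] with x hx
  rw [hx]
  by_cases h : x ∈ R <;> simp [h]

theorem positionProb_truncate {R : Set ℝ} (hR : MeasurableSet R) (ψ : HSpace) :
    positionProb R (truncate hR ψ) = ‖truncate hR ψ‖ ^ 2 := by
  rw [norm_sq_truncate, positionProb, positionProb]
  refine setIntegral_congr_ae hR ?_
  filter_upwards [truncate_coeFn hR ψ] with x hx h
  rw [hx, Set.indicator_of_mem h]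

theorem norm_sq_sub_truncate {R : Set ℝ} (hR : MeasurableSet R) (ψ : HSpace) :
    ‖ψ - truncate hR ψ‖ ^ 2 = ‖ψ‖ ^ 2 - positionProb R ψ := by
  rw [norm_sq_eq_integral ψ, positionProb, ← integral_add_compl hR (integrable_norm_sq ψ),
    add_sub_cancel_left, norm_sq_eq_integral, ← integral_indicator hR.compl]
  refine integral_congr_ae ?_
  filter_upwards [truncate_coeFn hR ψ, Lp.coeFn_sub ψ (truncate hR ψ)] with x hx h2
  rw [h2, Pi.sub_apply, hx]
  by_cases h : x ∈ R <;> simp [h]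

/-! ### Pure states and the variational principle -/

/-- A mixture has position support in `R` exactly when all its wave functions are supported in
`R`. -/
theorem trace_comp_spectralProj_eq_one_iff {ρ : HSpace →L[ℂ] HSpace} {R : Set ℝ}
    (hR : MeasurableSet R) {φ : basisIndex → HSpace} (hφ : HasSum (fun j => ‖φ j‖ ^ 2) 1)
    (hs : Summable fun j => (inner ℂ (φ j) (spectralProj R posX (φ j)) : ℂ))
    (h : HasSum (fun i => (inner ℂ (stdBasis i) (ρ (spectralProj R posX (stdBasis i))) : ℂ))
      (∑' j, inner ℂ (φ j) (spectralProj R posX (φ j)))) :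
    trace (ρ.comp (spectralProj R posX)) = 1 ↔ ∀ j, positionProb R (φ j) = ‖φ j‖ ^ 2 := by
  have ht : trace (ρ.comp (spectralProj R posX)) =
      ∑' j, inner ℂ (φ j) (spectralProj R posX (φ j)) := h.tsum_eq
  simp only [inner_spectralProj_posX hR] at ht hs
  have hs' : Summable fun j => positionProb R (φ j) := Complex.summable_ofReal.1 hs
  have hd := hφ.sub hs'.hasSum
  rw [ht, ← Complex.ofReal_tsum, Complex.ofReal_eq_one]
  constructor
  · intro h1 j
    rw [h1, sub_self, hasSum_zero_iff_of_nonneg fun j => sub_nonneg.2 (positionProb_le R _)] at hd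
    exact (sub_eq_zero.1 (congrFun hd j)).symm
  · intro h1
    simp only [h1, hφ.tsum_eq]

theorem positionStates_mono {R R' : Set ℝ} (hR : MeasurableSet R) (hR' : MeasurableSet R')
    (h : R ⊆ R') : positionStates R ⊆ positionStates R' := by
  rintro ρ ⟨hρ, h1⟩
  obtain ⟨φ, hφ, hQ⟩ := hρ.exists_vectors
  refine ⟨hρ, (trace_comp_spectralProj_eq_one_iff hR' hφ (hQ _).1
    ((hQ _).2 _ isParseval_stdBasis)).2 fun j => (positionProb_le _ _).antisymm ?_⟩
  rw [← (trace_comp_spectralProj_eq_one_iff hR hφ (hQ _).1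
    ((hQ _).2 _ isParseval_stdBasis)).1 h1 j]
  exact positionProb_mono h _

theorem hasSum_rankOne (ψ : HSpace) (Q : HSpace →L[ℂ] HSpace) :
    HasSum (fun i => (inner ℂ (stdBasis i)
      (((InnerProductSpace.rankOne ℂ ψ ψ).comp Q) (stdBasis i)) : ℂ)) (inner ℂ ψ (Q ψ)) := by
  have h := stdBasis.hasSum_inner_mul_inner (ContinuousLinearMap.adjoint Q ψ) ψ
  rw [ContinuousLinearMap.adjoint_inner_left] at h
  refine h.congr_fun fun i => ?_
  rw [ContinuousLinearMap.comp_apply, InnerProductSpace.rankOne_apply, inner_smul_right,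
    ContinuousLinearMap.adjoint_inner_left]

theorem trace_rankOne_comp (ψ : HSpace) (Q : HSpace →L[ℂ] HSpace) :
    trace ((InnerProductSpace.rankOne ℂ ψ ψ).comp Q) = inner ℂ ψ (Q ψ) :=
  (hasSum_rankOne ψ Q).tsum_eq

theorem rankOne_mem_positionStates {R : Set ℝ} (hR : MeasurableSet R) {ψ : HSpace}
    (hψ : ‖ψ‖ = 1) (h : positionProb R ψ = ‖ψ‖ ^ 2) :
    InnerProductSpace.rankOne ℂ ψ ψ ∈ positionStates R := by
  refine ⟨⟨InnerProductSpace.isPositive_rankOne_self ψ, ?_⟩, ?_⟩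
  · have := hasSum_rankOne ψ (ContinuousLinearMap.id ℂ HSpace)
    rw [ContinuousLinearMap.comp_id, ContinuousLinearMap.id_apply, inner_self_eq_norm_sq_to_K,
      hψ] at this
    simpa using this
  · rw [trace_rankOne_comp, inner_spectralProj_posX hR, h, hψ]
    simp

theorem positionProb_smul (R : Set ℝ) (c : ℂ) (ψ : HSpace) :
    positionProb R (c • ψ) = ‖c‖ ^ 2 * positionProb R ψ := by
  rw [positionProb, positionProb, ← integral_const_mul]
  refine integral_congr_ae (ae_restrict_of_ae ?_)
  filter_upwards [Lp.coeFn_smul c ψ] with x hx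
  rw [hx, Pi.smul_apply, norm_smul, mul_pow]

/-- Mixtures do not increase the supremum of an expectation value. -/
theorem forall_trace_le_iff {R : Set ℝ} (hR : MeasurableSet R) (Q : HSpace →L[ℂ] HSpace)
    (u : ℝ) : (∀ ρ ∈ positionStates R, (trace (ρ.comp Q)).re ≤ u) ↔
      ∀ ψ : HSpace, positionProb R ψ = ‖ψ‖ ^ 2 → (inner ℂ ψ (Q ψ) : ℂ).re ≤ u * ‖ψ‖ ^ 2 := by
  constructor
  · intro h ψ hψ
    rcases eq_or_ne ψ 0 with rfl | h0
    · simp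
    have hn : 0 < ‖ψ‖ := norm_pos_iff.2 h0
    have hc : ‖((‖ψ‖⁻¹ : ℝ) : ℂ)‖ = ‖ψ‖⁻¹ := by
      rw [Complex.norm_real, Real.norm_of_nonneg (by positivity)]
    have h1 : ‖((‖ψ‖⁻¹ : ℝ) : ℂ) • ψ‖ = 1 := by
      rw [norm_smul, hc, inv_mul_cancel₀ hn.ne']
    have h2 := h _ (rankOne_mem_positionStates hR h1 (by
      rw [positionProb_smul, hψ, norm_smul, mul_pow]))
    rw [trace_rankOne_comp, map_smul, inner_smul_left, inner_smul_right, Complex.conj_ofReal,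
      Complex.re_ofReal_mul, Complex.re_ofReal_mul] at h2
    field_simp at h2
    linarith
  · rintro h ρ ⟨hρ, h1⟩
    obtain ⟨φ, hφ, hQ⟩ := hρ.exists_vectors
    have h2 := (trace_comp_spectralProj_eq_one_iff hR hφ (hQ _).1
      ((hQ _).2 _ isParseval_stdBasis)).1 h1
    have h3 : trace (ρ.comp Q) = ∑' j, inner ℂ (φ j) (Q (φ j)) :=
      ((hQ Q).2 _ isParseval_stdBasis).tsum_eq
    have h4 := Complex.hasSum_re (hQ Q).1.hasSum
    rw [h3, ← mul_one u]
    exact hasSum_le (fun j => h _ (h2 j)) h4 (hφ.mul_left u)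

theorem bddAbove_values {R : Set ℝ} (hR : MeasurableSet R) (Q : HSpace →L[ℂ] HSpace) :
    BddAbove (Problem.mk (positionStates R) Q).values := by
  refine ⟨‖Q‖, ?_⟩
  rintro v ⟨ρ, hρ, rfl⟩
  refine (forall_trace_le_iff hR Q ‖Q‖).2 (fun ψ _ => ?_) ρ hρ
  calc (inner ℂ ψ (Q ψ) : ℂ).re ≤ ‖(inner ℂ ψ (Q ψ) : ℂ)‖ := Complex.re_le_norm _
    _ ≤ ‖ψ‖ * ‖Q ψ‖ := norm_inner_le_norm _ _
    _ ≤ ‖ψ‖ * (‖Q‖ * ‖ψ‖) := by gcongr; exact Q.le_opNorm ψ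
    _ = ‖Q‖ * ‖ψ‖ ^ 2 := by ring

theorem positionStates_Icc_nonempty {a b : ℝ} (hab : a < b) :
    (positionStates (Set.Icc a b)).Nonempty := by
  have hv : (volume : Measure ℝ) (Set.Icc a b) ≠ ⊤ := by simp
  set χ : HSpace := indicatorConstLp 2 measurableSet_Icc hv (1 : ℂ) with hχ
  have hne : χ ≠ 0 := by
    rw [← norm_pos_iff, hχ, norm_indicatorConstLp (by norm_num) (by norm_num)]
    have : 0 < (volume : Measure ℝ).real (Set.Icc a b) := by
      rw [Real.volume_real_Icc_of_le hab.le]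
      linarith
    rw [norm_one, one_mul]
    positivity
  have hn : 0 < ‖χ‖ := norm_pos_iff.2 hne
  have htr : truncate (measurableSet_Icc (a := a) (b := b)) χ = χ := by
    refine Lp.ext ?_
    filter_upwards [truncate_coeFn (measurableSet_Icc (a := a) (b := b)) χ,
      indicatorConstLp_coeFn (p := 2) (hs := measurableSet_Icc) (hμs := hv) (c := (1 : ℂ))]
      with x h1 h2
    rw [h1]
    by_cases h : x ∈ Set.Icc a b
    · rw [Set.indicator_of_mem h]
    · rw [Set.indicator_of_notMem h, hχ, h2, Set.indicator_of_notMem h]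
  have hp := positionProb_truncate (measurableSet_Icc (a := a) (b := b)) χ
  rw [htr] at hp
  refine ⟨_, rankOne_mem_positionStates measurableSet_Icc (ψ := ((‖χ‖⁻¹ : ℝ) : ℂ) • χ) ?_ ?_⟩
  · rw [norm_smul, Complex.norm_real, Real.norm_of_nonneg (by positivity), inv_mul_cancel₀ hn.ne']
  · rw [positionProb_smul, hp, norm_smul, mul_pow]

theorem isLUB_value {R : Set ℝ} (hR : MeasurableSet R) {a b : ℝ} (hab : a < b)
    (h : Set.Icc a b ⊆ R) (Q : HSpace →L[ℂ] HSpace) :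
    IsLUB (Problem.mk (positionStates R) Q).values (Problem.mk (positionStates R) Q).value := by
  refine isLUB_csSup ?_ (bddAbove_values hR Q)
  obtain ⟨ρ, hρ⟩ := positionStates_Icc_nonempty hab
  exact ⟨_, ρ, positionStates_mono measurableSet_Icc hR h hρ, rfl⟩

theorem isLUB_standard {α : ℝ} (hα : 0 < α) : IsLUB (standard α).values (phi α) :=
  isLUB_value measurableSet_Icc (neg_lt_zero.2 (Real.sqrt_pos.2 hα)) subset_rfl _

theorem isLUB_extended (β : ℝ) : IsLUB (extended β).values (extended β).value :=
  isLUB_value measurableSet_Iic (sub_one_lt β) Set.Icc_subset_Iic_self _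

theorem isLUB_standardInfinite : IsLUB standardInfinite.values phiInfinity :=
  isLUB_extended 0

/-! ### The limit `α → ∞` -/

theorem values_mono {R R' : Set ℝ} (hR : MeasurableSet R) (hR' : MeasurableSet R') (h : R ⊆ R')
    (Q : HSpace →L[ℂ] HSpace) :
    (Problem.mk (positionStates R) Q).values ⊆ (Problem.mk (positionStates R') Q).values := by
  rintro v ⟨ρ, hρ, rfl⟩
  exact ⟨ρ, positionStates_mono hR hR' h hρ, rfl⟩

theorem monotoneOn_phi : MonotoneOn phi (Set.Ioi 0) := fun _ hα _ hα' h =>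
  (isLUB_standard hα).mono (isLUB_standard hα') (values_mono measurableSet_Icc measurableSet_Icc
    (Set.Icc_subset_Icc_left (neg_le_neg (Real.sqrt_le_sqrt h))) _)

theorem tendsto_truncate {ψ : HSpace} (hψ : positionProb (Set.Iic 0) ψ = ‖ψ‖ ^ 2) :
    Tendsto (fun n : ℕ => truncate (measurableSet_Icc (a := -((n : ℝ) + 1)) (b := 0)) ψ) atTop
      (𝓝 ψ) := by
  have hU : ⋃ n : ℕ, Set.Icc (-((n : ℝ) + 1)) 0 = Set.Iic 0 := by
    ext x
    simp only [Set.mem_iUnion, Set.mem_Icc, Set.mem_Iic]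
    refine ⟨fun ⟨_, h⟩ => h.2, fun h => ?_⟩
    obtain ⟨n, hn⟩ := exists_nat_ge (-x)
    exact ⟨n, by linarith, h⟩
  have h1 : Tendsto (fun n : ℕ => positionProb (Set.Icc (-((n : ℝ) + 1)) 0) ψ) atTop
      (𝓝 (‖ψ‖ ^ 2)) := by
    rw [← hψ, ← hU]
    refine tendsto_setIntegral_of_monotone (fun n => measurableSet_Icc) (fun m n hmn => ?_)
      (integrable_norm_sq ψ).integrableOn
    refine Set.Icc_subset_Icc_left ?_
    have : (m : ℝ) ≤ n := by exact_mod_cast hmn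
    linarith
  rw [tendsto_iff_norm_sub_tendsto_zero]
  have h2 : Tendsto (fun n : ℕ => √(‖ψ‖ ^ 2 - positionProb (Set.Icc (-((n : ℝ) + 1)) 0) ψ)) atTop
      (𝓝 0) := by
    have := (tendsto_const_nhds (x := ‖ψ‖ ^ 2)).sub h1
    rw [sub_self] at this
    simpa using this.sqrt
  refine h2.congr fun n => ?_
  rw [← norm_sq_sub_truncate measurableSet_Icc, Real.sqrt_sq (norm_nonneg _), norm_sub_rev]

/-- Wave functions on the half line are limits of their restrictions to bounded intervals, so that
`φ(∞)` is the supremum of the `φ(α)`. -/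
theorem isLUB_phi : IsLUB (phi '' Set.Ioi 0) phiInfinity := by
  refine ⟨?_, fun u hu => ?_⟩
  · rintro _ ⟨α, hα, rfl⟩
    exact (isLUB_standard hα).mono isLUB_standardInfinite
      (values_mono measurableSet_Icc measurableSet_Iic Set.Icc_subset_Iic_self _)
  · refine isLUB_standardInfinite.2 ?_
    rintro v ⟨ρ, hρ, rfl⟩
    refine (forall_trace_le_iff measurableSet_Iic _ u).2 (fun ψ hψ => ?_) ρ hρ
    have hlim := tendsto_truncate hψ
    set Ω := standardInfinite.op
    refine le_of_tendsto_of_tendsto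
      (f := fun n : ℕ => (inner ℂ (truncate (measurableSet_Icc (a := -((n : ℝ) + 1)) (b := 0)) ψ)
        (Ω (truncate (measurableSet_Icc (a := -((n : ℝ) + 1)) (b := 0)) ψ)) : ℂ).re)
      (g := fun n : ℕ =>
        u * ‖truncate (measurableSet_Icc (a := -((n : ℝ) + 1)) (b := 0)) ψ‖ ^ 2) (b := atTop)
      ?_ ?_ (Eventually.of_forall fun n => ?_)
    · exact (Complex.continuous_re.tendsto _).comp
        (hlim.inner ((Ω.continuous.tendsto ψ).comp hlim))
    · exact (hlim.norm.pow 2).const_mul u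
    · have hn : (0 : ℝ) < n + 1 := by positivity
      have hα : 0 < ((n : ℝ) + 1) ^ 2 := by positivity
      refine (forall_trace_le_iff measurableSet_Icc Ω u).1 (fun ρ hρ => ?_) _
        (positionProb_truncate _ _)
      refine ((isLUB_standard hα).1 ⟨ρ, ?_, rfl⟩).trans (hu ⟨_, hα, rfl⟩)
      change ρ ∈ positionStates _
      rwa [Real.sqrt_sq hn.le]

theorem tendsto_phi : Tendsto phi atTop (𝓝 phiInfinity) := by
  have hmono : Monotone fun a : Set.Ioi (0 : ℝ) => phi a := fun a b h =>
    monotoneOn_phi a.2 b.2 h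
  have h := tendsto_atTop_isLUB hmono (a := phiInfinity) (by
    have := isLUB_phi
    rwa [Set.image_eq_range] at this)
  rwa [tendsto_comp_val_Ioi_atTop] at h

/-! ### Equivalences between the problems -/

/-- A unitary that acts on the groups generated by the `a X + b P + c` through `σ` carries
problems with position support to problems given by the transformed spectral projections. -/
theorem metaplecticEquiv_of_implements {U : HSpace ≃ₗᵢ[ℂ] HSpace} {σ : AffineMap2}
    (hσ : σ.fst.a * σ.snd.b - σ.fst.b * σ.snd.a = 1) (hU : Implements U 1 σ) {p q : Problem}
    {R : Set ℝ} (hR : MeasurableSet R) (hp : p.states = positionStates R)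
    (hq : q.states = statesIn (spectralProj R (posX.comp σ))) {A B : Affine}
    (hpo : p.op = heaviside A - heaviside B)
    (hqo : q.op = heaviside (A.comp σ) - heaviside (B.comp σ)) :
    MetaplecticEquiv σ p q := by
  have hexp : ∀ A t, conjUnitary U (expGroup A t) = expGroup (A.comp σ) (1 * t) := fun A t => by
    ext ψ : 1
    change U (expGroup A t (U.symm ψ)) = _
    rw [hU, U.apply_symm_apply]
  have hproj : ∀ (A : Affine) {R : Set ℝ}, MeasurableSet R →
      conjUnitary U (spectralProj R A) = spectralProj R (A.comp σ) := fun A _ hR =>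
    (WignerSymmetry.ofUnitary U).conj_spectralProj (hexp A) hR
  refine ⟨hσ, U, fun A t => by rw [hexp, one_mul], ?_, ?_⟩
  · rw [hp, hq, ← hproj posX hR]
    refine (WignerSymmetry.ofUnitary U).image_statesIn (WignerSymmetry.ofUnitary U.symm)
      (fun T => ?_) (fun T => ?_) _
    · ext ψ : 1
      change U (U.symm (T (U (U.symm ψ)))) = T ψ
      rw [U.apply_symm_apply, U.apply_symm_apply]
    · ext ψ : 1
      change U.symm (U (T (U.symm (U ψ)))) = T ψ
      rw [U.symm_apply_apply, U.symm_apply_apply]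
  · rw [hpo, hqo]
    unfold heaviside
    rw [← hproj A measurableSet_Ici, ← hproj B measurableSet_Ici]
    ext ψ : 1
    exact map_sub U _ _

/-- The antiunitary counterpart of `metaplecticEquiv_of_implements`. -/
theorem antiMetaplecticEquiv_of_implements {J : HSpace ≃ₗᵢ⋆[ℂ] HSpace} {σ : AffineMap2}
    (hσ : σ.fst.a * σ.snd.b - σ.fst.b * σ.snd.a = -1) (hJ : Implements J (-1) σ) {p q : Problem}
    {R : Set ℝ} (hR : MeasurableSet R) (hp : p.states = positionStates R)
    (hq : q.states = statesIn (spectralProj R (posX.comp σ))) {A B : Affine}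
    (hpo : p.op = heaviside A - heaviside B)
    (hqo : q.op = heaviside (A.comp σ) - heaviside (B.comp σ)) :
    AntiMetaplecticEquiv σ p q := by
  have hexp : ∀ A t, conjAntiunitary J (expGroup A t) = expGroup (A.comp σ) (-1 * t) :=
    fun A t => by
      ext ψ : 1
      change J (expGroup A t (J.symm ψ)) = _
      rw [hJ, J.apply_symm_apply]
  have hproj : ∀ (A : Affine) {R : Set ℝ}, MeasurableSet R →
      conjAntiunitary J (spectralProj R A) = spectralProj R (A.comp σ) := fun A _ hR =>
    (WignerSymmetry.ofAntiunitary J).conj_spectralProj (hexp A) hR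
  refine ⟨hσ, J, fun A t => by rw [hexp, neg_one_mul], ?_, ?_⟩
  · rw [hp, hq, ← hproj posX hR]
    refine (WignerSymmetry.ofAntiunitary J).image_statesIn (WignerSymmetry.ofAntiunitary J.symm)
      (fun T => ?_) (fun T => ?_) _
    · ext ψ : 1
      change J (J.symm (T (J (J.symm ψ)))) = T ψ
      rw [J.apply_symm_apply, J.apply_symm_apply]
    · ext ψ : 1
      change J.symm (J (T (J.symm (J ψ)))) = T ψ
      rw [J.symm_apply_apply, J.symm_apply_apply]
  · rw [hpo, hqo]
    unfold heaviside
    rw [← hproj A measurableSet_Ici, ← hproj B measurableSet_Ici]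
    ext ψ : 1
    exact map_sub J _ _

theorem MetaplecticEquiv.values_eq {σ : AffineMap2} {p q : Problem} (h : MetaplecticEquiv σ p q)
    (hp : ∀ ρ ∈ p.states, IsState ρ) : p.values = q.values := by
  obtain ⟨-, U, -, hs, ho⟩ := h
  exact (WignerSymmetry.ofUnitary U).values_eq hp hs ho

theorem AntiMetaplecticEquiv.values_eq {σ : AffineMap2} {p q : Problem}
    (h : AntiMetaplecticEquiv σ p q) (hp : ∀ ρ ∈ p.states, IsState ρ) : p.values = q.values := by
  obtain ⟨-, J, -, hs, ho⟩ := h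
  exact (WignerSymmetry.ofAntiunitary J).values_eq hp hs ho

theorem AntiMetaplecticEquiv.isLUB {σ : AffineMap2} {β : ℝ} {q : Problem}
    (h : AntiMetaplecticEquiv σ (extended β) q) : IsLUB q.values (extended β).value := by
  rw [← h.values_eq fun ρ hρ => hρ.1]
  exact isLUB_extended β

theorem spectralProj_rescale_of_eq {A A' : Affine} (k d : ℝ) {R R' : Set ℝ}
    (hR : MeasurableSet R) (ha : A'.a = k * A.a) (hb : A'.b = k * A.b) (hc : A'.c = k * A.c + d)
    (h : ∀ s, k * s + d ∈ R ↔ s ∈ R') : spectralProj R A' = spectralProj R' A := by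
  have h1 : A' = ⟨k * A.a, k * A.b, k * A.c + d⟩ := by ext <;> simp [ha, hb, hc]
  have h2 : (fun s => k * s + d) ⁻¹' R = R' := Set.ext h
  rw [h1, spectralProj_rescale _ _ _ hR, h2]

/-- Translation along the direction `(1, -1)` of phase space, which leaves `X + P` invariant. -/
theorem metaplecticEquiv_penalized (β : ℝ) :
    MetaplecticEquiv ⟨⟨1, 0, -β⟩, ⟨0, 1, β⟩⟩ (penalized (-β)) (extended β) := by
  have hU := implements_substPhaseEquiv one_pos (-β) (-β) 0
  simp only [neg_zero, inv_one, div_one, neg_neg] at hU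
  refine metaplecticEquiv_of_implements (by norm_num) hU (R := Set.Iic 0) measurableSet_Iic rfl ?_
    rfl ?_
  · refine congrArg statesIn (spectralProj_rescale_of_eq 1 (-β) measurableSet_Iic ?_ ?_ ?_ ?_).symm
    all_goals simp [Affine.comp, posX]
  · change heaviside _ - heaviside _ = _
    congr 2 <;> simp [Affine.comp, momP]

/-- The antiunitary that exchanges position and momentum up to factors, followed by a boost. The
scale `(2 π s)⁻¹` compensates for the `2 π` in the normalization of the Fourier transform. -/
theorem exists_implements_exchange {s : ℝ} (hs : 0 < s) (g : ℝ) :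
    ∃ J : HSpace ≃ₗᵢ⋆[ℂ] HSpace, Implements J (-1) ⟨⟨0, -s, s * g⟩, ⟨-s⁻¹, 0, 0⟩⟩ := by
  have hpi := Real.pi_pos
  have hk : 0 < (2 * Real.pi * s)⁻¹ := by positivity
  refine ⟨(complexConj.trans (Lp.fourierTransformₗᵢ ℝ ℂ)).trans (substPhaseEquiv hk 0
    (q := fun x => 0 * x ^ 2 / 2 + g * x) (by fun_prop)), ?_⟩
  have hFK : Implements (fun ψ => Lp.fourierTransformₗᵢ ℝ ℂ (complexConj ψ)) (1 * -1)
      ⟨⟨0, -(2 * Real.pi)⁻¹, 0⟩, ⟨-(2 * Real.pi), 0, 0⟩⟩ :=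
    implements_fourier.comp implements_complexConj fun A => by ext <;> simp [Affine.comp]
  have := (implements_substPhaseEquiv hk 0 g 0).comp hFK
    (υ := ⟨⟨0, -s, s * g⟩, ⟨-s⁻¹, 0, 0⟩⟩) fun A => by
      ext
      · simp only [Affine.comp]
        field_simp
        ring
      · simp only [Affine.comp]
        field_simp
        ring
      · simp only [Affine.comp]
        field_simp
        ring
  rw [one_mul, one_mul] at this
  exact this

/-- Time reversal, followed by a rescaling, a translation and multiplication by a quadratic phase. -/
theorem exists_implements_reversal {k : ℝ} (hk : 0 < k) (l m : ℝ) :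
    ∃ J : HSpace ≃ₗᵢ⋆[ℂ] HSpace, Implements J (-1)
      ⟨⟨k, 0, -(k * l)⟩, ⟨-(k⁻¹ * m), -k⁻¹, k⁻¹ * m * l⟩⟩ := by
  refine ⟨complexConj.trans (substPhaseEquiv hk (-(k * l))
    (q := fun x => -m * x ^ 2 / 2 + m * l * x) (by fun_prop)), ?_⟩
  have := (implements_substPhaseEquiv hk (-(k * l)) (m * l) (-m)).comp implements_complexConj
    (υ := ⟨⟨k, 0, -(k * l)⟩, ⟨-(k⁻¹ * m), -k⁻¹, k⁻¹ * m * l⟩⟩) fun A => by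
      ext
      · simp only [Affine.comp]
        field_simp
        ring
      · simp only [Affine.comp]
        field_simp
        ring
      · simp only [Affine.comp]
        field_simp
        ring
  rw [one_mul] at this
  exact this

theorem sqrt_div_comm_eq_inv (x y : ℝ) : √(x / y) = (√(y / x))⁻¹ := by
  rw [← Real.sqrt_inv, inv_div]

theorem antiMetaplecticEquiv_exchange {M ΔT : ℝ} (hM : 0 < M) (hT : 0 < ΔT) (g γ : ℝ)
    {q : Problem} (hq : q.states = momentumStates (Set.Ici (g - γ)))
    (hqo : q.op = heaviside ⟨-1, -(ΔT / M), ΔT / M * g⟩ - heaviside ⟨-1, 0, 0⟩) :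
    AntiMetaplecticEquiv ⟨⟨0, -√(ΔT / M), √(ΔT / M) * g⟩, ⟨-√(M / ΔT), 0, 0⟩⟩
      (extended (√(ΔT / M) * γ)) q := by
  rw [sqrt_div_comm_eq_inv M ΔT]
  have hsq : √(ΔT / M) ^ 2 = ΔT / M := Real.sq_sqrt (by positivity)
  have hs : 0 < √(ΔT / M) := by positivity
  rw [← hsq] at hqo
  set s := √(ΔT / M)
  obtain ⟨J, hJ⟩ := exists_implements_exchange hs g
  refine antiMetaplecticEquiv_of_implements (by simp [hs.ne']) hJ (R := Set.Iic (s * γ))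
    measurableSet_Iic rfl ?_ rfl ?_
  · rw [hq]
    refine congrArg statesIn (spectralProj_rescale_of_eq (-s) (s * g) measurableSet_Iic
      (by simp [Affine.comp, posX, momP]) (by simp [Affine.comp, posX, momP])
      (by simp [Affine.comp, posX, momP]) fun x => ?_).symm
    have : -s * x + s * g = s * (g - x) := by ring
    rw [Set.mem_Iic, Set.mem_Ici, this, mul_le_mul_iff_right₀ hs]
    constructor <;> intro h <;> linarith
  · rw [hqo]
    congr 1
    · refine (heaviside_rescale s⁻¹ (by positivity) ?_ ?_ ?_).symm <;>
        simp only [Affine.comp] <;> field_simp <;> ring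
    · refine (heaviside_rescale s⁻¹ (by positivity) ?_ ?_ ?_).symm <;>
        simp [Affine.comp, momP]

theorem antiMetaplecticEquiv_generalizedBackflow {M ΔT : ℝ} (hM : 0 < M) (hT : 0 < ΔT) (γ : ℝ) :
    AntiMetaplecticEquiv ⟨⟨0, -√(ΔT / M), 0⟩, ⟨-√(M / ΔT), 0, 0⟩⟩
      (extended (√(ΔT / M) * γ)) (generalizedBackflow M ΔT γ) := by
  have h := antiMetaplecticEquiv_exchange hM hT 0 γ (q := generalizedBackflow M ΔT γ)
    (by rw [zero_sub]; rfl) (by rw [mul_zero]; rfl)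
  rwa [mul_zero] at h

theorem antiMetaplecticEquiv_forceBackflow {M ΔT : ℝ} (hM : 0 < M) (hT : 0 < ΔT) (F : ℝ) :
    AntiMetaplecticEquiv ⟨⟨0, -√(ΔT / M), √(ΔT / M) * (F * ΔT / 2)⟩, ⟨-√(M / ΔT), 0, 0⟩⟩
      (extended (√(ΔT / M) * (F * ΔT / 2))) (forceBackflow M ΔT F) := by
  refine antiMetaplecticEquiv_exchange hM hT (F * ΔT / 2) (F * ΔT / 2)
    (by rw [sub_self]; rfl) ?_
  have : ΔT / M * (F * ΔT / 2) = F * ΔT ^ 2 / (2 * M) := by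
    field_simp
  rw [this]
  rfl

theorem antiMetaplecticEquiv_backflow {M ΔT : ℝ} (hM : 0 < M) (hT : 0 < ΔT) :
    AntiMetaplecticEquiv ⟨⟨0, -√(ΔT / M), 0⟩, ⟨-√(M / ΔT), 0, 0⟩⟩
      (extended 0) (backflow M ΔT) := by
  have h := antiMetaplecticEquiv_exchange hM hT 0 0 (q := backflow M ΔT)
    (by rw [sub_self]; rfl) (by rw [mul_zero]; rfl)
  rwa [mul_zero] at h

theorem antiMetaplecticEquiv_reentry {M t₁ t₂ C : ℝ} (l : ℝ) (hM : 0 < M)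
    (ht₁ : 0 < t₁) (ht : t₁ < t₂) (hC : C = (t₂ - t₁) / t₂) :
    AntiMetaplecticEquiv
      ⟨⟨√(M * C / t₁), 0, -(√(M * C / t₁) * l)⟩,
        ⟨-√(M / (t₁ * C)), -(√(M / (t₁ * C)) * (t₁ / M)), √(M / (t₁ * C)) * l⟩⟩
      (extended (-(√(M * C / t₁) * l))) (reentry M l t₁ t₂) := by
  have ht₂ : 0 < t₂ := ht₁.trans ht
  have hC0 : 0 < C := by
    rw [hC]
    exact div_pos (sub_pos.2 ht) ht₂
  have hk : 0 < √(M * C / t₁) := Real.sqrt_pos.2 (by positivity)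
  have hsq : √(M * C / t₁) ^ 2 = M * C / t₁ := Real.sq_sqrt (by positivity)
  have hr : √(M / (t₁ * C)) = (√(M * C / t₁))⁻¹ * (M / t₁) := by
    rw [Real.sqrt_eq_iff_mul_self_eq_of_pos (by positivity)]
    have : (√(M * C / t₁))⁻¹ * (M / t₁) * ((√(M * C / t₁))⁻¹ * (M / t₁)) =
        (√(M * C / t₁) ^ 2)⁻¹ * (M / t₁) ^ 2 := by ring
    rw [this, hsq]
    field_simp
  rw [hr]
  set k := √(M * C / t₁)
  obtain ⟨J, hJ⟩ := exists_implements_reversal hk l (M / t₁)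
  have hb : k⁻¹ * (M / t₁) * (t₁ / M) = k⁻¹ := by field_simp
  rw [hb]
  have hk2 : k = k⁻¹ * (M / t₁) * C := by
    field_simp
    rw [hsq]
    field_simp
  refine antiMetaplecticEquiv_of_implements (by simp [hk.ne']) hJ
    (R := Set.Iic (-(k * l))) measurableSet_Iic rfl ?_ rfl ?_
  · refine congrArg statesIn (spectralProj_rescale_of_eq k (-(k * l)) measurableSet_Iic
      (by simp [Affine.comp, posX]) (by simp [Affine.comp, posX])
      (by simp [Affine.comp, posX]) fun x => ?_).symm
    rw [Set.mem_Iic, Set.mem_Iic, add_le_iff_nonpos_left]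
    exact ⟨fun h => nonpos_of_mul_nonpos_right h hk,
      fun h => mul_nonpos_of_nonneg_of_nonpos hk.le h⟩
  · change heaviside _ - heaviside _ = _
    have hC1 : 1 - C = t₁ / t₂ := by
      rw [hC]
      field_simp
      ring
    congr 1
    · have hr0 : 0 < k⁻¹ * (M / t₁) * (t₁ / t₂) := by positivity
      refine (heaviside_rescale (k⁻¹ * (M / t₁) * (t₁ / t₂)) hr0 ?_ ?_ ?_).symm
      · simp only [Affine.comp]
        rw [← hC1]
        linear_combination hk2
      · simp only [Affine.comp]
        field_simp
        ring
      · simp only [Affine.comp]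
        rw [← hC1]
        linear_combination -l * hk2
    · refine (heaviside_rescale (k⁻¹ * (M / t₁)) (by positivity) ?_ ?_ ?_).symm
      · simp [Affine.comp, momP]
      · simp only [Affine.comp, momP]
        field_simp
        ring
      · simp [Affine.comp, momP]

end

end Backflow

theorem mainTheorem2 :
    -- the suprema are suprema of nonempty sets of numbers that are bounded above
    (∀ α : ℝ, 0 < α → IsLUB (standard α).values (phi α)) ∧
    IsLUB standardInfinite.values phiInfinity ∧
    (∀ β : ℝ, IsLUB (extended β).values (extended β).value) ∧
    -- `φ(∞)` is the limit and the supremum of the nondecreasing function `φ`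
    MonotoneOn phi (Set.Ioi 0) ∧
    Tendsto phi atTop (𝓝 phiInfinity) ∧
    IsLUB (phi '' Set.Ioi 0) phiInfinity ∧
    -- `φ(∞) = c_bm`, through an anti-metaplectic transformation
    (∀ M ΔT : ℝ, 0 < M → 0 < ΔT →
      IsLUB (backflow M ΔT).values (brackenMelloy M ΔT) ∧
      phiInfinity = brackenMelloy M ΔT ∧
      AntiMetaplecticEquiv ⟨⟨0, -√(ΔT / M), 0⟩, ⟨-√(M / ΔT), 0, 0⟩⟩
        standardInfinite (backflow M ΔT)) ∧
    -- the two forms of the extended standard problem with `α = ∞`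
    (∀ β : ℝ,
      IsLUB (penalized (-β)).values (extended β).value ∧
      MetaplecticEquiv ⟨⟨1, 0, -β⟩, ⟨0, 1, β⟩⟩ (penalized (-β)) (extended β)) ∧
    -- generalized backflow
    (∀ M ΔT γ : ℝ, 0 < M → 0 < ΔT →
      IsLUB (generalizedBackflow M ΔT γ).values (extended (√(ΔT / M) * γ)).value ∧
      AntiMetaplecticEquiv ⟨⟨0, -√(ΔT / M), 0⟩, ⟨-√(M / ΔT), 0, 0⟩⟩
        (extended (√(ΔT / M) * γ)) (generalizedBackflow M ΔT γ)) ∧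
    -- backflow under a constant force of either direction
    (∀ M ΔT F : ℝ, 0 < M → 0 < ΔT →
      IsLUB (forceBackflow M ΔT F).values (extended (√(ΔT / M) * (F * ΔT / 2))).value ∧
      AntiMetaplecticEquiv
        ⟨⟨0, -√(ΔT / M), √(ΔT / M) * (F * ΔT / 2)⟩, ⟨-√(M / ΔT), 0, 0⟩⟩
        (extended (√(ΔT / M) * (F * ΔT / 2))) (forceBackflow M ΔT F)) ∧
    -- quantum reentry
    (∀ M l t₁ t₂ C : ℝ, 0 < M → 0 ≤ l → 0 < t₁ → t₁ < t₂ → C = (t₂ - t₁) / t₂ →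
      IsLUB (reentry M l t₁ t₂).values (extended (-(√(M * C / t₁) * l))).value ∧
      AntiMetaplecticEquiv
        ⟨⟨√(M * C / t₁), 0, -(√(M * C / t₁) * l)⟩,
          ⟨-√(M / (t₁ * C)), -(√(M / (t₁ * C)) * (t₁ / M)), √(M / (t₁ * C)) * l⟩⟩
        (extended (-(√(M * C / t₁) * l))) (reentry M l t₁ t₂)) := by
  refine ⟨fun α => isLUB_standard, isLUB_standardInfinite, isLUB_extended, monotoneOn_phi,
    tendsto_phi, isLUB_phi, fun M ΔT hM hT => ?_, fun β => ?_, fun M ΔT γ hM hT => ?_,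
    fun M ΔT F hM hT => ?_, fun M l t₁ t₂ C hM _ ht₁ ht hC => ?_⟩
  · have h := antiMetaplecticEquiv_backflow hM hT
    -- `φ(∞)` is the value of the extended problem with `β = 0`.
    have hval : phiInfinity = brackenMelloy M ΔT :=
      congrArg sSup (h.values_eq fun ρ hρ => hρ.1)
    exact ⟨hval ▸ h.isLUB, hval, h⟩
  · have h := metaplecticEquiv_penalized β
    refine ⟨?_, h⟩
    rw [h.values_eq fun ρ hρ => hρ.1]
    exact isLUB_extended β
  · have h := antiMetaplecticEquiv_generalizedBackflow hM hT γ
    exact ⟨h.isLUB, h⟩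
  · have h := antiMetaplecticEquiv_forceBackflow hM hT F
    exact ⟨h.isLUB, h⟩
  · have h := antiMetaplecticEquiv_reentry l hM ht₁ ht hC
    exact ⟨h.isLUB, h⟩
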